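/- Let $M$ be a smooth $n$-dimensional manifold, let $f:M\to\mathbb R^{n+1}$ be a smooth immersion, and let $\xi:M\to\mathbb R^{n+1}$ be a smooth vector field along $f$ that is transversal to $f$ and such that $D_X\xi$ is tangent to the hypersurface for every tangent vector $X$ of $M$, where $D$ is the standard flat connection of $\mathbb R^{n+1}$. Let the induced connection $\nabla$, the second fundamental form $g$ and the shape operator $S$ be defined by $$D_Xf_*Y=f_*(\nabla_XY)+g(X,Y)\xi,\qquad D_X\xi=-f_*(SX),$$ and assume that $g$ is positive definite, i.e. the hypersurface is locally strongly convex and the sign of $\xi$ is chosen accordingly. Assume that $(f,\xi)$ is a hyperbolic or parabolic equiaffine sphere: $S=H\,\mathrm{id}$ for a function $H$ on $M$ with $H<0$ everywhere (hyperbolic) or $H=0$ everywhere (parabolic). Let $\hat\nabla$, $\hat R$, $\widehat{\mathrm{Ric}}$ and $\hat\rho$ be the Levi-Civita connection, the curvature tensor, the Ricci tensor and the scalar curvature of the Riemannian metric $g$. Let $A=-\tfrac12\nabla g$ be the cubic form, and let $\tau(X)=\mathrm{tr}_g\,A(X,\cdot,\cdot)$ be the Czebyshev form. If $\hat\nabla\tau=0$,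 $\widehat{\mathrm{Ric}}\ge 0$ and $\hat\rho$ is constant on $M$, then $\hat R=0$ and $\hat\nabla A=0$. -/

import Mathlib

open scoped Manifold ContDiff

noncomputable section

namespace EquiaffineGeometry

/-- The model space `ℝⁿ`. -/
abbrev Rn (n : ℕ) : Type := EuclideanSpace ℝ (Fin n)

/-- The `i`-th coordinate vector. -/
def coordVec {n : ℕ} (i : Fin n) : Rn n := EuclideanSpace.single i (1 : ℝ)

/-! ### Tensor calculus in a coordinate domain of `ℝⁿ`

A (local) tensor field is a function of the point `y` and of constant vectors `u, v, w, …`;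
a connection is given by its Christoffel map `Γ y u v`, the covariant derivative at `y` in the
direction `u` of the constant vector field `v`. -/

/-- The derivative at `y`, in the direction `u`, of a function `φ`. -/
def dirDeriv {n : ℕ} {F : Type*} [NormedAddCommGroup F] [NormedSpace ℝ F]
    (φ : Rn n → F) (y u : Rn n) : F :=
  fderiv ℝ φ y u

/-- `(∇_u τ)(v)` for a `1`-form `τ` and the connection with Christoffel map `Γ`. -/
def covDerivOne {n : ℕ} (Γ : Rn n → Rn n → Rn n → Rn n) (τ : Rn n → Rn n → ℝ)
    (y u v : Rn n) : ℝ :=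
  dirDeriv (fun z => τ z v) y u - τ y (Γ y u v)

/-- `(∇_u B)(v, w)` for a `(0,2)`-tensor field `B`. -/
def covDerivTwo {n : ℕ} (Γ : Rn n → Rn n → Rn n → Rn n) (B : Rn n → Rn n → Rn n → ℝ)
    (y u v w : Rn n) : ℝ :=
  dirDeriv (fun z => B z v w) y u - B y (Γ y u v) w - B y v (Γ y u w)

/-- `(∇_u A)(v, w, x)` for a `(0,3)`-tensor field `A`. -/
def covDerivThree {n : ℕ} (Γ : Rn n → Rn n → Rn n → Rn n) (A : Rn n → Rn n → Rn n → Rn n → ℝ)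
    (y u v w x : Rn n) : ℝ :=
  dirDeriv (fun z => A z v w x) y u
    - A y (Γ y u v) w x - A y v (Γ y u w) x - A y v w (Γ y u x)

/-- The curvature tensor `R(u, v)w = ∇_u ∇_v w - ∇_v ∇_u w - ∇_[u, v] w` of a connection,
evaluated on constant vector fields. -/
def curvature {n : ℕ} (Γ : Rn n → Rn n → Rn n → Rn n) (y u v w : Rn n) : Rn n :=
  dirDeriv (fun z => Γ z v w) y u - dirDeriv (fun z => Γ z u w) y v
    + Γ y u (Γ y v w) - Γ y v (Γ y u w)

/-- The Ricci tensor `Ric(v, w) = tr (u ↦ R(u, v)w)` of a connection. -/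
def ricci {n : ℕ} (Γ : Rn n → Rn n → Rn n → Rn n) (y v w : Rn n) : ℝ :=
  ∑ i : Fin n, curvature Γ y (coordVec i) v w i

/-- The inverse matrix `(g^{ij})` of the matrix `g_{ij}` of a metric tensor at `y`. -/
def inverseMetric {n : ℕ} (g : Rn n → Rn n → Rn n → ℝ) (y : Rn n) : Matrix (Fin n) (Fin n) ℝ :=
  (Matrix.of fun i j => g y (coordVec i) (coordVec j))⁻¹

/-- The trace at `y` of a bilinear form with respect to the metric `g`. -/
def metricTrace {n : ℕ} (g : Rn n → Rn n → Rn n → ℝ) (y : Rn n) (B : Rn n → Rn n → ℝ) : ℝ :=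
  ∑ i : Fin n, ∑ j : Fin n, inverseMetric g y i j * B (coordVec i) (coordVec j)

/-- The Christoffel map of the Levi-Civita connection of `g`:
`Γ^k(u, v) = ½ ∑_l g^{kl} (∂_u g(v, e_l) + ∂_v g(u, e_l) - ∂_l g(u, v))`. -/
def leviCivita {n : ℕ} (g : Rn n → Rn n → Rn n → ℝ) (y u v : Rn n) : Rn n :=
  ∑ k : Fin n, (∑ l : Fin n, inverseMetric g y k l * ((1 / 2 : ℝ) *
    (dirDeriv (fun z => g z v (coordVec l)) y u
      + dirDeriv (fun z => g z u (coordVec l)) y v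
      - dirDeriv (fun z => g z u v) y (coordVec l)))) • coordVec k

/-- The scalar curvature of the metric `g`. -/
def scalarCurvature {n : ℕ} (g : Rn n → Rn n → Rn n → ℝ) (y : Rn n) : ℝ :=
  metricTrace g y (ricci (leviCivita g) y)

/-! ### A parametrized piece of hypersurface `F` with transversal field `ζ` -/

/-- The linear map `(v, t) ↦ F_* v + t ζ` from `ℝⁿ × ℝ` to `ℝⁿ⁺¹`. It is bijective when `F` is an
immersion at `y` and `ζ` is transversal at `y`. -/
def gaussFrame {n : ℕ} (F ζ : Rn n → Rn (n + 1)) (y : Rn n) : (Rn n × ℝ) →L[ℝ] Rn (n + 1) :=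
  (fderiv ℝ F y).coprod (ContinuousLinearMap.toSpanSingleton ℝ (ζ y))

/-- The tangential part of a vector of `ℝⁿ⁺¹`: the `v` in `p = F_* v + t ζ`. -/
def tangentPart {n : ℕ} (F ζ : Rn n → Rn (n + 1)) (y : Rn n) (p : Rn (n + 1)) : Rn n :=
  ((gaussFrame F ζ y).inverse p).1

/-- The transversal part of a vector of `ℝⁿ⁺¹`: the `t` in `p = F_* v + t ζ`. -/
def transversalPart {n : ℕ} (F ζ : Rn n → Rn (n + 1)) (y : Rn n) (p : Rn (n + 1)) : ℝ :=
  ((gaussFrame F ζ y).inverse p).2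

/-- The induced connection `∇` in the Gauss formula `D_u F_* v = F_*(∇_u v) + g(u, v) ζ`. -/
def inducedConnection {n : ℕ} (F ζ : Rn n → Rn (n + 1)) (y u v : Rn n) : Rn n :=
  tangentPart F ζ y (dirDeriv (fun z => dirDeriv F z v) y u)

/-- The second fundamental form `g` in the Gauss formula `D_u F_* v = F_*(∇_u v) + g(u, v) ζ`. -/
def secondForm {n : ℕ} (F ζ : Rn n → Rn (n + 1)) (y u v : Rn n) : ℝ :=
  transversalPart F ζ y (dirDeriv (fun z => dirDeriv F z v) y u)

/-- The shape operator `S` in the Weingarten formula `D_v ζ = - F_*(S v)`. -/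
def shapeOperator {n : ℕ} (F ζ : Rn n → Rn (n + 1)) (y v : Rn n) : Rn n :=
  - tangentPart F ζ y (dirDeriv ζ y v)

/-- The cubic form `A = -½ ∇g` of the induced structure `(g, ∇)`. -/
def cubicForm {n : ℕ} (F ζ : Rn n → Rn (n + 1)) (y u v w : Rn n) : ℝ :=
  -(1 / 2 : ℝ) * covDerivTwo (inducedConnection F ζ) (secondForm F ζ) y u v w

/-- The Czebyshev form `τ(u) = tr_g A(u, ·, ·)`. -/
def czebyshevForm {n : ℕ} (F ζ : Rn n → Rn (n + 1)) (y u : Rn n) : ℝ :=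
  metricTrace (secondForm F ζ) y (cubicForm F ζ y u)

/-- The Christoffel map of the Levi-Civita connection of the second fundamental form. -/
def hatConnection {n : ℕ} (F ζ : Rn n → Rn (n + 1)) : Rn n → Rn n → Rn n → Rn n :=
  leviCivita (secondForm F ζ)

/-! ### Equiaffine hypersurfaces on a manifold -/

section Manifold

variable {n : ℕ} {M : Type*} [TopologicalSpace M] [ChartedSpace (Rn n) M]

/-- `P F ζ y` holds for the coordinate representations `F`, `ζ` of `f`, `ξ` in every chart of the
smooth manifold `M` and at every point `y` of the coordinate domain of the chart. -/
def InCharts (f ξ : M → Rn (n + 1))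
    (P : (Rn n → Rn (n + 1)) → (Rn n → Rn (n + 1)) → Rn n → Prop) : Prop :=
  ∀ e ∈ IsManifold.maximalAtlas (𝓡 n) ∞ M, ∀ y ∈ e.target, P (f ∘ e.symm) (ξ ∘ e.symm) y

/-- `(f, ξ)` is a locally strongly convex equiaffine hypersurface: `f : M → ℝⁿ⁺¹` is a smooth
immersion, `ξ` is a smooth transversal field, `D_X ξ` is always tangent to the hypersurface, and
the second fundamental form is positive definite (the usual choice of the sign of `ξ`). -/
structure IsEquiaffineHypersurface (f ξ : M → Rn (n + 1)) : Prop where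
  smooth_immersion : ContMDiff (𝓡 n) 𝓘(ℝ, Rn (n + 1)) ∞ f
  smooth_field : ContMDiff (𝓡 n) 𝓘(ℝ, Rn (n + 1)) ∞ ξ
  immersion : ∀ x : M, Function.Injective (mfderiv (𝓡 n) 𝓘(ℝ, Rn (n + 1)) f x)
  transversal : ∀ x : M, ∀ v : TangentSpace (𝓡 n) x,
    mfderiv (𝓡 n) 𝓘(ℝ, Rn (n + 1)) f x v ≠ ξ x
  equiaffine : ∀ x : M, ∀ v : TangentSpace (𝓡 n) x, ∃ w : TangentSpace (𝓡 n) x,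
    mfderiv (𝓡 n) 𝓘(ℝ, Rn (n + 1)) ξ x v = mfderiv (𝓡 n) 𝓘(ℝ, Rn (n + 1)) f x w
  convex : InCharts f ξ fun F ζ y => ∀ v : Rn n, v ≠ 0 → 0 < secondForm F ζ y v v

/-- `(f, ξ)` is an equiaffine sphere, and `H` is the function with `S = H id`. -/
structure IsEquiaffineSphere (f ξ : M → Rn (n + 1)) (H : M → ℝ) : Prop where
  hypersurface : IsEquiaffineHypersurface f ξ
  shape : ∀ e ∈ IsManifold.maximalAtlas (𝓡 n) ∞ M, ∀ y ∈ e.target, ∀ v : Rn n,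
    shapeOperator (f ∘ e.symm) (ξ ∘ e.symm) y v = H (e.symm y) • v

/-- A hyperbolic equiaffine sphere: `S = H id` with `H < 0`. -/
def IsHyperbolicSphere (f ξ : M → Rn (n + 1)) : Prop :=
  ∃ H : M → ℝ, IsEquiaffineSphere f ξ H ∧ ∀ x, H x < 0

/-- A parabolic equiaffine sphere: `S = H id` with `H = 0`. -/
def IsParabolicSphere (f ξ : M → Rn (n + 1)) : Prop :=
  ∃ H : M → ℝ, IsEquiaffineSphere f ξ H ∧ ∀ x, H x = 0

end Manifold

end EquiaffineGeometry

end

/-! Work in a chart with the Levi-Civita connection Γ of g and the difference tensor K = ∇ - Γ, so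
that A(u, v, w) = g(K_u v, w). Write ∇̂ for covariant differentiation with Γ.

The structure equations come from the symmetry of higher derivatives. For the third derivative of F
it gives, for the induced connection, curvature H · (g(a, ·)s - g(s, ·)a) and the Codazzi equation
for ∇g (`gauss_codazzi`); for the second derivative of ζ it gives dH(w)v = dH(v)w, hence (n - 1) dH
= 0. The curvature of Γ + K is R̂(s, a) + (∇̂_s K_a - ∇̂_a K_s) + [K_s, K_a]. Here R̂, the
commutator and the model curvature are g-skew, while the ∇̂K term is g-selfadjoint. So ∇̂K is
totally symmetric, and R̂ = H · wedge - [K, K].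

Parallelism of τ makes every trace of ∇̂K vanish. In the contracted Gauss equation ρ̂ = n(n - 1)H -
|τ|² + |K|² the first two terms have zero derivative, so constancy of ρ̂ forces |K|² to be constant.
A second differentiation gives ⟨ΔK, K⟩ + |∇̂K|² = 0. Total symmetry, the Ricci identity and the
vanishing traces turn ΔK into curvature terms, a Simons-type formula, with the result
(`IsOrthonormalFor.bochner`) |R̂|² + |∇̂K|² - 2Hρ̂ + Σ Ric(K_c a, K_c a) = 0. Since H ≤ 0 and Ric ≥
0, each term is nonnegative, hence zero. This gives R̂ = 0 and ∇̂K = 0, and the latter is ∇̂A = 0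
because g is parallel. -/

noncomputable section

namespace EquiaffineGeometry

/-! ### Traces and orthonormal bases for a positive definite form -/

section Algebra

variable {V : Type*} [NormedAddCommGroup V] [NormedSpace ℝ V]

/-- The trace of an endomorphism, as a continuous linear functional. -/
def opTrace [FiniteDimensional ℝ V] : (V →L[ℝ] V) →L[ℝ] ℝ :=
  LinearMap.toContinuousLinearMap (LinearMap.trace ℝ V ∘ₗ ContinuousLinearMap.coeLM ℝ)

theorem opTrace_apply [FiniteDimensional ℝ V] (P : V →L[ℝ] V) :
    opTrace P = LinearMap.trace ℝ V (P : V →ₗ[ℝ] V) := rfl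

theorem opTrace_mul_comm [FiniteDimensional ℝ V] (P Q : V →L[ℝ] V) :
    opTrace (P * Q) = opTrace (Q * P) :=
  LinearMap.trace_mul_comm ℝ (P : V →ₗ[ℝ] V) (Q : V →ₗ[ℝ] V)

theorem opTrace_one [FiniteDimensional ℝ V] :
    opTrace (1 : V →L[ℝ] V) = Module.finrank ℝ V :=
  LinearMap.trace_one ℝ V

/-- The basis `E` is orthonormal for the bilinear form `g`. -/
def IsOrthonormalFor {ι : Type*} [DecidableEq ι] (g : V →L[ℝ] V →L[ℝ] ℝ)
    (E : Module.Basis ι ℝ V) : Prop :=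
  ∀ i j, g (E i) (E j) = if i = j then 1 else 0

theorem exists_isOrthonormalFor [FiniteDimensional ℝ V] (g : V →L[ℝ] V →L[ℝ] ℝ)
    (hs : ∀ v w, g v w = g w v) (hp : ∀ v, v ≠ 0 → 0 < g v v) :
    ∃ E : Module.Basis (Fin (Module.finrank ℝ V)) ℝ V, IsOrthonormalFor g E := by
  -- The form g induces its own norm. Passing to a bare vector space W keeps that norm from clashing
  -- with the one V already carries.
  suffices H : ∀ (W : Type _) [AddCommGroup W] [Module ℝ W] [FiniteDimensional ℝ W]
      (b : W →ₗ[ℝ] W →ₗ[ℝ] ℝ), (∀ v w, b v w = b w v) → (∀ v, v ≠ 0 → 0 < b v v) →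
      ∃ E : Module.Basis (Fin (Module.finrank ℝ W)) ℝ W,
        ∀ i j, b (E i) (E j) = if i = j then 1 else 0 from
    H V ((ContinuousLinearMap.coeLM ℝ) ∘ₗ (g : V →ₗ[ℝ] (V →L[ℝ] ℝ))) hs hp
  intro W _ _ _ b hs hp
  let c : InnerProductSpace.Core ℝ W :=
    { inner := fun v w => b v w
      conj_inner_symm := fun v w => hs w v
      re_inner_nonneg := fun v => by
        rcases eq_or_ne v 0 with rfl | h
        · simp
        · exact (hp v h).le
      add_left := fun v w x => by simp
      smul_left := fun v w r => by simp
      definite := fun v h => by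
        by_contra h'
        exact (hp v h').ne' h }
  let _ := c.toNormedAddCommGroup
  let _ : InnerProductSpace ℝ W := InnerProductSpace.ofCore c.toCore
  refine ⟨(stdOrthonormalBasis ℝ W).toBasis, fun i j => ?_⟩
  have := orthonormal_iff_ite.1 (stdOrthonormalBasis ℝ W).orthonormal i j
  rw [OrthonormalBasis.coe_toBasis]
  exact this

variable {ι : Type*} [Fintype ι] [DecidableEq ι] {g : V →L[ℝ] V →L[ℝ] ℝ} {E : Module.Basis ι ℝ V}

theorem IsOrthonormalFor.repr_apply (hE : IsOrthonormalFor g E) (v : V) (i : ι) :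
    E.repr v i = g v (E i) := by
  conv_rhs => rw [← E.sum_repr v]
  rw [map_sum, sum_apply]
  simp [hE _ i]

theorem IsOrthonormalFor.sum_smul (hE : IsOrthonormalFor g E) (v : V) :
    ∑ i, g v (E i) • E i = v := by
  conv_rhs => rw [← E.sum_repr v]
  simp [hE.repr_apply]

theorem IsOrthonormalFor.sum_mul (hE : IsOrthonormalFor g E) (v w : V) :
    ∑ i, g v (E i) * g (E i) w = g v w := by
  conv_rhs => rw [← hE.sum_smul v]
  simp

theorem IsOrthonormalFor.opTrace_eq [FiniteDimensional ℝ V] (hE : IsOrthonormalFor g E)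
    (P : V →L[ℝ] V) : opTrace P = ∑ i, g (P (E i)) (E i) := by
  rw [opTrace_apply, LinearMap.trace_eq_matrix_trace ℝ E, Matrix.trace]
  simp [LinearMap.toMatrix_apply, hE.repr_apply]

theorem IsOrthonormalFor.opTrace_mul_smulRight [FiniteDimensional ℝ V] (hE : IsOrthonormalFor g E)
    (hs : ∀ v w, g v w = g w v) (P : V →L[ℝ] V) (a s : V) :
    opTrace (P * (g a).smulRight s) = g a (P s) := by
  rw [hE.opTrace_eq]
  simp only [mul_apply_eq_comp, ContinuousLinearMap.smulRight_apply, map_smul,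
    smul_apply, smul_eq_mul]
  rw [← hE.sum_mul]
  exact Finset.sum_congr rfl fun i _ => by rw [hs (P s)]

theorem IsOrthonormalFor.opTrace_mul_self [FiniteDimensional ℝ V] (hE : IsOrthonormalFor g E) {P : V →L[ℝ] V}
    (hP : ∀ v w, g (P v) w = g v (P w)) : opTrace (P * P) = ∑ i, g (P (E i)) (P (E i)) := by
  simp [hE.opTrace_eq, hP]

theorem IsOrthonormalFor.opTrace_mul_self_skew [FiniteDimensional ℝ V] (hE : IsOrthonormalFor g E) {P : V →L[ℝ] V}
    (hP : ∀ v w, g (P v) w = - g v (P w)) : opTrace (P * P) = -∑ i, g (P (E i)) (P (E i)) := by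
  simp [hE.opTrace_eq, hP]

theorem nonneg_of_pos (hp : ∀ v, v ≠ 0 → 0 < g v v) (v : V) : 0 ≤ g v v := by
  rcases eq_or_ne v 0 with rfl | h
  · simp
  · exact (hp v h).le

theorem eq_zero_of_sum_nonpos (hp : ∀ v, v ≠ 0 → 0 < g v v) {P : V →L[ℝ] V}
    (h : ∑ i, g (P (E i)) (P (E i)) ≤ 0) : P = 0 := by
  have h0 : ∀ i, P (E i) = 0 := by
    intro i
    by_contra hi
    have h1 := hp _ hi
    have h2 := Finset.single_le_sum (f := fun i => g (P (E i)) (P (E i)))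
      (fun i _ => nonneg_of_pos hp _) (Finset.mem_univ i)
    linarith
  exact ContinuousLinearMap.coe_injective (E.ext fun i => h0 i)

/-- The endomorphism `z ↦ g(a, z) s - g(s, z) a`. -/
def wedgeOp (g : V →L[ℝ] V →L[ℝ] ℝ) (s a : V) : V →L[ℝ] V :=
  (g a).smulRight s - (g s).smulRight a

theorem wedgeOp_skew (hs : ∀ v w, g v w = g w v) (s a v w : V) :
    g (wedgeOp g s a v) w = - g v (wedgeOp g s a w) := by
  simp [wedgeOp, hs v]
  ring

/-! ### The Bochner–Simons identity in a single tangent space. -/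

variable {K : V →L[ℝ] V →L[ℝ] V} {D : V → V → V →L[ℝ] V} {D₂ : V → V → V → V →L[ℝ] V}
  {R : V → V → V →L[ℝ] V} {H : ℝ}

theorem commutator_skew (hK : ∀ u v w, g (K u v) w = g v (K u w)) (s a v w : V) :
    g ((K s * K a - K a * K s) v) w = - g v ((K s * K a - K a * K s) w) := by
  simp [hK]

/-- A parallel trace makes the contraction `∑ P(s, s)` of a totally symmetric `P` vanish. -/
theorem IsOrthonormalFor.sum_diag_eq_zero [FiniteDimensional ℝ V] (hE : IsOrthonormalFor g E)
    (hp : ∀ v, v ≠ 0 → 0 < g v v) {P : V → V → V →L[ℝ] V}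
    (hP : ∀ u v, P u v = P v u) (hP' : ∀ u v w, P u v w = P u w v)
    (hsa : ∀ u v w x, g (P u v w) x = g w (P u v x)) (htr : ∀ u v, opTrace (P u v) = 0) :
    ∑ s, P (E s) (E s) = 0 := by
  -- Total symmetry makes all contractions of P agree, so this one equals the trace of P(v, w).
  have key : ∀ v w, g ((∑ s, P (E s) (E s)) v) w = 0 := by
    intro v w
    rw [← htr v w, hE.opTrace_eq, sum_apply, map_sum,
      sum_apply]
    refine Finset.sum_congr rfl fun s _ => ?_
    rw [hP' (E s) (E s) v, hP (E s) v, hsa, hP' v (E s) w, ← hsa, hsa]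
  ext v
  by_contra h
  exact (hp _ h).ne' (key _ _)

/-- **Bochner argument at a point.** -/
theorem IsOrthonormalFor.bochner [FiniteDimensional ℝ V] (hE : IsOrthonormalFor g E)
    (hs : ∀ v w, g v w = g w v) (hp : ∀ v, v ≠ 0 → 0 < g v v)
    (hKs : ∀ u v, K u v = K v u) (hK : ∀ u v w, g (K u v) w = g v (K u w))
    (hDsa : ∀ u v w x, g (D u v w) x = g w (D u v x))
    (hD₂ : ∀ a u v, D₂ a u v = D₂ a v u) (hD₂' : ∀ a u v w, D₂ a u v w = D₂ a u w v)
    (hD₂sa : ∀ a u v w x, g (D₂ a u v w) x = g w (D₂ a u v x))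
    (hD₂tr : ∀ a u v, opTrace (D₂ a u v) = 0)
    (hR : ∀ s a, R s a = H • wedgeOp g s a - (K s * K a - K a * K s))
    (hcomm : ∀ s u v, D₂ s u v - D₂ u s v = R s u * K v - K v * R s u - K (R s u v))
    (hH : H ≤ 0) (hRic : ∀ v, 0 ≤ ∑ s, g (R (E s) v v) (E s))
    (hlap : ∑ s, ∑ a, (opTrace (D₂ (E s) (E s) (E a) * K (E a)) +
      opTrace (D (E s) (E a) * D (E s) (E a))) = 0) :
    (∀ s a, D (E s) (E a) = 0) ∧ (∀ s a, R (E s) (E a) = 0) := by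
  have hRsk : ∀ s a v w, g (R s a v) w = - g v (R s a w) := by
    intro s a v w
    have h1 := wedgeOp_skew hs s a v w
    have h2 := commutator_skew hK s a v w
    rw [hR]
    simp only [sub_apply, smul_apply, map_sub, map_smul,
      smul_eq_mul] at h1 h2 ⊢
    linear_combination H * h1 - h2
  have hdiag : ∀ a, ∑ s, D₂ a (E s) (E s) = 0 := fun a =>
    hE.sum_diag_eq_zero hp (hD₂ a) (hD₂' a) (hD₂sa a) (hD₂tr a)
  -- S is the Ricci operator: g(S v, v) = Ric(v, v).
  set S : V → V := fun v => -∑ s, R (E s) v (E s) with hS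
  have hric : ∀ v, 0 ≤ g (S v) v := by
    intro v
    have : g (S v) v = ∑ s, g (R (E s) v v) (E s) := by
      simp only [hS, map_neg, map_sum, neg_apply,
        sum_apply, ← Finset.sum_neg_distrib]
      refine Finset.sum_congr rfl fun s _ => ?_
      rw [hRsk, neg_neg, hs]
    rw [this]
    exact hRic v
  -- R is only a function of its first two arguments, so linearity of S is not automatic. The
  -- formula for T is S with the Gauss equation substituted and K_v moved out of the way by symmetry
  -- of K.
  have hSlin : ∃ T : V →L[ℝ] V, ∀ v, T v = S v := by
    refine ⟨-∑ s, (H • ((g.flip (E s)).smulRight (E s) - g (E s) (E s) • 1) -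
      (K (E s) * K (E s) - K (K (E s) (E s)))), fun v => ?_⟩
    simp only [hS, hR, wedgeOp]
    simp [hKs v]
  obtain ⟨T, hT⟩ := hSlin
  -- the three groups of terms
  have hS1 : ∀ s a, opTrace (D (E s) (E a) * D (E s) (E a)) =
      ∑ i, g (D (E s) (E a) (E i)) (D (E s) (E a) (E i)) := fun s a =>
    hE.opTrace_mul_self (hDsa _ _)
  -- Cyclicity of the trace turns the left side into tr(R(s, a)[K_s, K_a]), and the Gauss equation
  -- replaces the commutator by H · wedge - R(s, a). Skewness of R turns -tr R² into the square
  -- norm.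
  have hS2 : ∀ s a, opTrace ((R s a * K s - K s * R s a) * K a) =
      ∑ i, g (R s a (E i)) (R s a (E i)) - 2 * H * g (R s a a) s := by
    intro s a
    have e1 : opTrace ((R s a * K s - K s * R s a) * K a) =
        opTrace (R s a * (K s * K a - K a * K s)) := by
      have := opTrace_mul_comm (K s) (R s a * K a)
      rw [sub_mul, mul_sub, map_sub, map_sub]
      simp only [mul_assoc] at this ⊢
      rw [this]
    have e2 : K s * K a - K a * K s = H • wedgeOp g s a - R s a := by rw [hR]; abel
    rw [e1, e2, mul_sub, map_sub, hE.opTrace_mul_self_skew (hRsk s a), mul_smul_comm, map_smul,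
      wedgeOp, mul_sub, map_sub, hE.opTrace_mul_smulRight hs, hE.opTrace_mul_smulRight hs,
      hs s, hs a, hRsk s a s a, hs s]
    simp only [smul_eq_mul]
    ring
  -- For each c the sum over a is tr(K_c² S) = tr(K_c S K_c), which becomes Ric evaluated on the
  -- vectors K_c a.
  have hS3 : ∑ a, opTrace (K (S (E a)) * K (E a)) = ∑ c, ∑ a, g (S (K (E c) (E a))) (K (E c) (E a)) := by
    have e1 : ∀ a, opTrace (K (S (E a)) * K (E a)) = ∑ c, g (T (E a)) (K (E c) (K (E c) (E a))) := by
      intro a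
      rw [opTrace_mul_comm, hE.opTrace_eq]
      refine Finset.sum_congr rfl fun c _ => ?_
      rw [mul_apply_eq_comp, hK, hKs _ (E c), hKs _ (E c), hK, hT]
    simp only [e1]
    rw [Finset.sum_comm]
    refine Finset.sum_congr rfl fun c _ => ?_
    have e2 := hE.opTrace_eq (T * (K (E c) * K (E c)))
    rw [← mul_assoc, opTrace_mul_comm, ← mul_assoc, hE.opTrace_eq] at e2
    have e3 := opTrace_mul_comm T (K (E c) * K (E c))
    rw [hE.opTrace_eq, hE.opTrace_eq] at e3
    simp only [mul_apply_eq_comp] at e2 e3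
    calc ∑ a, g (T (E a)) (K (E c) (K (E c) (E a)))
        = ∑ a, g (K (E c) (K (E c) (T (E a)))) (E a) := by
          refine Finset.sum_congr rfl fun a _ => by rw [hK, hK]
      _ = ∑ a, g (K (E c) (T (K (E c) (E a)))) (E a) := by
          have e4 := opTrace_mul_comm (K (E c)) (K (E c) * T)
          rw [hE.opTrace_eq, hE.opTrace_eq] at e4
          simpa only [mul_apply_eq_comp] using e4
      _ = _ := by
          refine Finset.sum_congr rfl fun a _ => by rw [hK, hT]
  -- Simons' step: swap the last two slots by the Codazzi symmetry, then commute the two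
  -- derivatives, so that the remaining second derivative becomes the contraction that `hdiag`
  -- annihilates.
  have hexp : ∀ s a, opTrace (D₂ s s a * K a) = opTrace (D₂ a s s * K a) +
      opTrace ((R s a * K s - K s * R s a) * K a) - opTrace (K (R s a s) * K a) := by
    intro s a
    have : D₂ s s a = D₂ a s s + (R s a * K s - K s * R s a) - K (R s a s) := by
      rw [hD₂ s s a]
      have := hcomm s a s
      rw [sub_eq_iff_eq_add] at this
      rw [this]; abel
    rw [this, sub_mul, add_mul, map_sub, map_add]
  have hz : ∑ s, ∑ a, opTrace (D₂ (E a) (E s) (E s) * K (E a)) = 0 := by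
    rw [Finset.sum_comm]
    refine Finset.sum_eq_zero fun a _ => ?_
    rw [← map_sum, ← Finset.sum_mul, hdiag, zero_mul, map_zero]
  have h3 : ∑ s, ∑ a, opTrace (K (R (E s) (E a) (E s)) * K (E a)) =
      -∑ a, opTrace (K (S (E a)) * K (E a)) := by
    rw [Finset.sum_comm, ← Finset.sum_neg_distrib]
    refine Finset.sum_congr rfl fun a _ => ?_
    rw [← map_sum, ← Finset.sum_mul, ← map_sum, hS]
    simp
  have htot : (∑ s, ∑ a, ∑ i, g (R (E s) (E a) (E i)) (R (E s) (E a) (E i))) +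
      (∑ s, ∑ a, ∑ i, g (D (E s) (E a) (E i)) (D (E s) (E a) (E i))) +
      (-2 * H) * (∑ a, ∑ s, g (R (E s) (E a) (E a)) (E s)) +
      ∑ c, ∑ a, g (S (K (E c) (E a))) (K (E c) (E a)) = 0 := by
    rw [← hlap]
    simp only [hexp, hS1, hS2, Finset.sum_add_distrib, Finset.sum_sub_distrib]
    rw [hz, h3, hS3, Finset.sum_comm (f := fun a s => g (R (E s) (E a) (E a)) (E s))]
    simp only [← Finset.mul_sum]
    ring
  have n1 : ∀ (P : V → V → V →L[ℝ] V) s a,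
      0 ≤ ∑ i, g (P (E s) (E a) (E i)) (P (E s) (E a) (E i)) :=
    fun P s a => Finset.sum_nonneg fun i _ => nonneg_of_pos hp _
  have n2 : ∀ (P : V → V → V →L[ℝ] V),
      0 ≤ ∑ s, ∑ a, ∑ i, g (P (E s) (E a) (E i)) (P (E s) (E a) (E i)) :=
    fun P => Finset.sum_nonneg fun s _ => Finset.sum_nonneg fun a _ => n1 P s a
  have n3 : 0 ≤ (-2 * H) * (∑ a, ∑ s, g (R (E s) (E a) (E a)) (E s)) :=
    mul_nonneg (by linarith) (Finset.sum_nonneg fun a _ => hRic _)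
  have n4 : 0 ≤ ∑ c, ∑ a, g (S (K (E c) (E a))) (K (E c) (E a)) :=
    Finset.sum_nonneg fun a _ => Finset.sum_nonneg fun a _ => hric _
  -- Stated for a general P so that it serves both D and R.
  have fin : ∀ (P : V → V → V →L[ℝ] V),
      ∑ s, ∑ a, ∑ i, g (P (E s) (E a) (E i)) (P (E s) (E a) (E i)) ≤ 0 →
      ∀ s a, P (E s) (E a) = 0 := by
    intro P h s a
    refine eq_zero_of_sum_nonpos (E := E) hp ?_
    have h1 := Finset.single_le_sum (f := fun s => ∑ a, ∑ i,
      g (P (E s) (E a) (E i)) (P (E s) (E a) (E i)))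
      (fun s _ => Finset.sum_nonneg fun a _ => n1 P s a) (Finset.mem_univ s)
    have h2 := Finset.single_le_sum (f := fun a => ∑ i,
      g (P (E s) (E a) (E i)) (P (E s) (E a) (E i)))
      (fun a _ => n1 P s a) (Finset.mem_univ a)
    exact (h2.trans h1).trans h
  have m1 := n2 D
  have m2 := n2 R
  exact ⟨fin D (by linarith), fin R (by linarith)⟩

end Algebra

section Calculus

variable {V : Type*} [NormedAddCommGroup V] [NormedSpace ℝ V]

/-! ### Covariant derivatives of endomorphism fields -/

/-- The covariant derivative `∇_u P` at `y` of a field `P` of endomorphisms. -/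
def covEnd (Γ : V → V →L[ℝ] V →L[ℝ] V) (P : V → V →L[ℝ] V) (y u : V) : V →L[ℝ] V :=
  fderiv ℝ P y u + Γ y u * P y - P y * Γ y u

/-- The covariant derivative `∇_u K` at `y` of a one-form `K` with values in endomorphisms. -/
def covForm (Γ K : V → V →L[ℝ] V →L[ℝ] V) (y u : V) : V →L[ℝ] V →L[ℝ] V :=
  fderiv ℝ K y u + (ContinuousLinearMap.mul ℝ (V →L[ℝ] V) (Γ y u)).comp (K y)
    - ((ContinuousLinearMap.mul ℝ (V →L[ℝ] V)).flip (Γ y u)).comp (K y) - (K y).comp (Γ y u)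

theorem covForm_apply (Γ K : V → V →L[ℝ] V →L[ℝ] V) (y u v : V) :
    covForm Γ K y u v =
      fderiv ℝ K y u v + Γ y u * K y v - K y v * Γ y u - K y (Γ y u v) := rfl

/-- The second covariant derivative `(∇²K)(s, u)(v)` of a one-form with values in
endomorphisms. -/
def covForm₂ (Γ K : V → V →L[ℝ] V →L[ℝ] V) (y s u v : V) : V →L[ℝ] V :=
  covEnd Γ (fun z => covForm Γ K z u v) y s - covForm Γ K y (Γ y s u) v
    - covForm Γ K y u (Γ y s v)

/-- The curvature endomorphism `R(u, v)` of a connection. -/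
def curvEnd (Γ : V → V →L[ℝ] V →L[ℝ] V) (y u v : V) : V →L[ℝ] V :=
  fderiv ℝ Γ y u v - fderiv ℝ Γ y v u + Γ y u * Γ y v - Γ y v * Γ y u

/-- The covariant derivative `∇_u B` at `y` of a field of bilinear forms. -/
def covBilin (Γ : V → V →L[ℝ] V →L[ℝ] V) (B : V → V →L[ℝ] V →L[ℝ] ℝ) (y u : V) :
    V →L[ℝ] V →L[ℝ] ℝ :=
  fderiv ℝ B y u - (B y).comp (Γ y u) - (B y).bilinearComp (ContinuousLinearMap.id ℝ V) (Γ y u)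

theorem covBilin_apply (Γ : V → V →L[ℝ] V →L[ℝ] V) (B : V → V →L[ℝ] V →L[ℝ] ℝ) (y u v w : V) :
    covBilin Γ B y u v w = fderiv ℝ B y u v w - B y (Γ y u v) w - B y v (Γ y u w) := rfl

theorem fderiv_apply_const {F G : Type*} [NormedAddCommGroup F] [NormedSpace ℝ F]
    [NormedAddCommGroup G] [NormedSpace ℝ G] {A : V → F →L[ℝ] G} {y : V}
    (hA : DifferentiableAt ℝ A y) (x : F) (u : V) :
    fderiv ℝ (fun z => A z x) y u = fderiv ℝ A y u x := by
  rw [fderiv_clm_apply hA (differentiableAt_const x)]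
  simp

theorem fderiv_apply_const₂ {F F' G : Type*} [NormedAddCommGroup F] [NormedSpace ℝ F]
    [NormedAddCommGroup F'] [NormedSpace ℝ F'] [NormedAddCommGroup G] [NormedSpace ℝ G]
    {A : V → F →L[ℝ] F' →L[ℝ] G} {y : V}
    (hA : DifferentiableAt ℝ A y) (x : F) (x' : F') (u : V) :
    fderiv ℝ (fun z => A z x x') y u = fderiv ℝ A y u x x' := by
  rw [fderiv_apply_const (hA.clm_apply (differentiableAt_const x)), fderiv_apply_const hA]

theorem fderiv_mul_apply {P Q : V → V →L[ℝ] V} {y : V} (hP : DifferentiableAt ℝ P y)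
    (hQ : DifferentiableAt ℝ Q y) (u : V) :
    fderiv ℝ (fun z => P z * Q z) y u = fderiv ℝ P y u * Q y + P y * fderiv ℝ Q y u := by
  rw [fderiv_fun_mul' hP hQ]
  simp [add_comm]

/-- The connection enters `covEnd` through a commutator, which is traceless. -/
theorem opTrace_covEnd [FiniteDimensional ℝ V] {Γ : V → V →L[ℝ] V →L[ℝ] V} {P : V → V →L[ℝ] V}
    {y : V} (hP : DifferentiableAt ℝ P y) (u : V) :
    opTrace (covEnd Γ P y u) = fderiv ℝ (fun z => opTrace (P z)) y u := by
  have h := (opTrace (V := V)).hasFDerivAt.comp y hP.hasFDerivAt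
  have h' : fderiv ℝ (fun z => opTrace (P z)) y u = opTrace (fderiv ℝ P y u) := by
    rw [show (fun z => opTrace (P z)) = (opTrace (V := V)) ∘ P from rfl, h.fderiv]
    rfl
  rw [h', covEnd, map_sub, map_add, opTrace_mul_comm (Γ y u)]
  ring

theorem covEnd_mul {Γ : V → V →L[ℝ] V →L[ℝ] V} {P Q : V → V →L[ℝ] V} {y : V}
    (hP : DifferentiableAt ℝ P y) (hQ : DifferentiableAt ℝ Q y) (u : V) :
    covEnd Γ (fun z => P z * Q z) y u = covEnd Γ P y u * Q y + P y * covEnd Γ Q y u := by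
  simp only [covEnd, fderiv_mul_apply hP hQ]
  noncomm_ring

theorem covForm_eq {Γ K : V → V →L[ℝ] V →L[ℝ] V} {y : V} (hK : DifferentiableAt ℝ K y)
    (u v : V) : covForm Γ K y u v = covEnd Γ (fun z => K z v) y u - K y (Γ y u v) := by
  rw [covForm_apply, covEnd, fderiv_apply_const hK]

/-! ### Smooth fields on open sets and the Ricci identity. -/

theorem ContDiffOn.fderiv_infty {F : Type*} [NormedAddCommGroup F] [NormedSpace ℝ F]
    {U : Set V} (hU : IsOpen U) {φ : V → F} (h : ContDiffOn ℝ ∞ φ U) :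
    ContDiffOn ℝ ∞ (fderiv ℝ φ) U :=
  h.fderiv_of_isOpen hU (by simp)

theorem ContDiffOn.differentiableAt_of_isOpen {F : Type*} [NormedAddCommGroup F] [NormedSpace ℝ F]
    {U : Set V} (hU : IsOpen U) {φ : V → F} (h : ContDiffOn ℝ ∞ φ U) {y : V} (hy : y ∈ U) :
    DifferentiableAt ℝ φ y :=
  ((h y hy).contDiffAt (hU.mem_nhds hy)).differentiableAt (by simp)

theorem fderiv_fderiv_symm {F : Type*} [NormedAddCommGroup F] [NormedSpace ℝ F]
    {U : Set V} (hU : IsOpen U) {φ : V → F} (h : ContDiffOn ℝ ∞ φ U) {y : V} (hy : y ∈ U)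
    (u v : V) : fderiv ℝ (fderiv ℝ φ) y u v = fderiv ℝ (fderiv ℝ φ) y v u :=
  (((h y hy).contDiffAt (hU.mem_nhds hy)).isSymmSndFDerivAt
    (by simpa using (WithTop.coe_le_coe.2 le_top : ((2 : ℕ∞) : WithTop ℕ∞) ≤ ∞))).eq u v

theorem fderiv_congr_of_isOpen {F : Type*} [NormedAddCommGroup F] [NormedSpace ℝ F]
    {U : Set V} (hU : IsOpen U) {φ ψ : V → F} (h : ∀ z ∈ U, φ z = ψ z) {y : V} (hy : y ∈ U) :
    fderiv ℝ φ y = fderiv ℝ ψ y :=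
  Filter.EventuallyEq.fderiv_eq (Filter.eventually_of_mem (hU.mem_nhds hy) h)

theorem contDiffOn_covForm [FiniteDimensional ℝ V] {Γ K : V → V →L[ℝ] V →L[ℝ] V} {U : Set V}
    (hU : IsOpen U) (hΓ : ContDiffOn ℝ ∞ Γ U) (hK : ContDiffOn ℝ ∞ K U) (u : V) :
    ContDiffOn ℝ ∞ (fun z => covForm Γ K z u) U := by
  rw [contDiffOn_clm_apply]
  intro v
  have h1 := ((ContDiffOn.fderiv_infty hU hK).clm_apply (contDiffOn_const (c := u))).clm_apply
    (contDiffOn_const (c := v))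
  have h2 := hΓ.clm_apply (contDiffOn_const (c := u))
  have h3 := hK.clm_apply (contDiffOn_const (c := v))
  exact ((h1.add (h2.mul h3)).sub (h3.mul h2)).sub
    (hK.clm_apply (h2.clm_apply (contDiffOn_const (c := v))))

theorem fderiv_covForm {Γ K : V → V →L[ℝ] V →L[ℝ] V} {U : Set V} (hU : IsOpen U)
    (hΓ : ContDiffOn ℝ ∞ Γ U) (hK : ContDiffOn ℝ ∞ K U) {y : V} (hy : y ∈ U) (s u v : V) :
    fderiv ℝ (fun z => covForm Γ K z u v) y s =
      fderiv ℝ (fderiv ℝ K) y s u v + fderiv ℝ Γ y s u * K y v + Γ y u * fderiv ℝ K y s v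
        - fderiv ℝ K y s v * Γ y u - K y v * fderiv ℝ Γ y s u
        - fderiv ℝ K y s (Γ y u v) - K y (fderiv ℝ Γ y s u v) := by
  have dΓ := ContDiffOn.differentiableAt_of_isOpen hU hΓ hy
  have dK := ContDiffOn.differentiableAt_of_isOpen hU hK hy
  have dK' := ContDiffOn.differentiableAt_of_isOpen hU (ContDiffOn.fderiv_infty hU hK) hy
  have dΓu := dΓ.clm_apply (differentiableAt_const u)
  have dΓuv := dΓu.clm_apply (differentiableAt_const v)
  have dKv := dK.clm_apply (differentiableAt_const v)
  have dK'u := dK'.clm_apply (differentiableAt_const u)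
  have dK'uv := dK'u.clm_apply (differentiableAt_const v)
  simp only [covForm_apply]
  rw [fderiv_fun_sub (((dK'uv.fun_add (dΓu.fun_mul dKv))).fun_sub (dKv.fun_mul dΓu))
      (dK.clm_apply dΓuv),
    fderiv_fun_sub (dK'uv.fun_add (dΓu.fun_mul dKv)) (dKv.fun_mul dΓu),
    fderiv_fun_add dK'uv (dΓu.fun_mul dKv), fderiv_clm_apply dK dΓuv]
  simp only [sub_apply, add_apply, fderiv_mul_apply dΓu dKv, fderiv_mul_apply dKv dΓu,
    fderiv_apply_const₂ dK', fderiv_apply_const dΓ, fderiv_apply_const dK,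
    ContinuousLinearMap.comp_apply, ContinuousLinearMap.flip_apply, fderiv_apply_const₂ dΓ]
  abel

/-- The Ricci identity for one-forms with values in endomorphisms. -/
theorem covForm₂_sub_swap {Γ K : V → V →L[ℝ] V →L[ℝ] V} {U : Set V} (hU : IsOpen U)
    (hΓ : ContDiffOn ℝ ∞ Γ U) (hK : ContDiffOn ℝ ∞ K U)
    (hsymm : ∀ y ∈ U, ∀ u v, Γ y u v = Γ y v u) {y : V} (hy : y ∈ U) (s u v : V) :
    covForm₂ Γ K y s u v - covForm₂ Γ K y u s v =
      curvEnd Γ y s u * K y v - K y v * curvEnd Γ y s u - K y (curvEnd Γ y s u v) := by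
  -- On antisymmetrising in s and u, the second derivatives of K cancel by Schwarz and the terms in
  -- Γ_s u by absence of torsion.
  simp only [covForm₂, covEnd, fderiv_covForm hU hΓ hK hy]
  simp only [curvEnd, covForm_apply,
    hsymm y hy u s, fderiv_fderiv_symm hU hK hy u s, add_apply, sub_apply, map_add, map_sub,
    mul_apply_eq_comp]
  noncomm_ring

end Calculus

/-! ### Metric traces -/

section Metric

variable {V : Type*} [NormedAddCommGroup V] [NormedSpace ℝ V] [FiniteDimensional ℝ V]

theorem isInvertible_of_pos {g : V →L[ℝ] V →L[ℝ] ℝ} (hp : ∀ v, v ≠ 0 → 0 < g v v) :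
    g.IsInvertible := by
  have hinj : Function.Injective (g : V →ₗ[ℝ] (V →L[ℝ] ℝ)) := by
    rw [injective_iff_map_eq_zero]
    intro v hv
    by_contra h
    have h1 := hp v h
    rw [show g v = 0 from hv] at h1
    simp at h1
  have hdim : Module.finrank ℝ V = Module.finrank ℝ (V →L[ℝ] ℝ) := by
    rw [← (LinearMap.toContinuousLinearMap (𝕜 := ℝ) (E := V) (F' := ℝ)).finrank_eq]
    exact (Subspace.dual_finrank_eq (K := ℝ) (V := V)).symm
  refine ⟨(LinearMap.linearEquivOfInjective _ hinj hdim).toContinuousLinearEquiv, ?_⟩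
  ext v
  rfl

/-- The endomorphism obtained by raising an index of the bilinear form `B`. -/
def raise (g B : V →L[ℝ] V →L[ℝ] ℝ) : V →L[ℝ] V := g.inverse.comp B

/-- The trace of the bilinear form `B` with respect to `g`. -/
def formTrace (g B : V →L[ℝ] V →L[ℝ] ℝ) : ℝ := opTrace (raise g B)

theorem raise_spec {g : V →L[ℝ] V →L[ℝ] ℝ} (hp : ∀ v, v ≠ 0 → 0 < g v v)
    (B : V →L[ℝ] V →L[ℝ] ℝ) (v w : V) : g (raise g B v) w = B v w := by
  rw [raise, ContinuousLinearMap.comp_apply, (isInvertible_of_pos hp).self_apply_inverse]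

theorem eq_of_forall_metric {g : V →L[ℝ] V →L[ℝ] ℝ} (hp : ∀ v, v ≠ 0 → 0 < g v v) {v w : V}
    (h : ∀ x, g v x = g w x) : v = w := by
  by_contra hvw
  have h1 := hp _ (sub_ne_zero.2 hvw)
  rw [show g (v - w) = 0 by ext x; simp [h x]] at h1
  exact lt_irrefl _ h1

theorem raise_eq {g : V →L[ℝ] V →L[ℝ] ℝ} (hp : ∀ v, v ≠ 0 → 0 < g v v)
    {B : V →L[ℝ] V →L[ℝ] ℝ} {P : V →L[ℝ] V} (h : ∀ v w, g (P v) w = B v w) : raise g B = P := by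
  ext v
  exact eq_of_forall_metric hp fun w => by rw [raise_spec hp, h]

theorem IsOrthonormalFor.formTrace_eq {ι : Type*} [Fintype ι] [DecidableEq ι]
    {g : V →L[ℝ] V →L[ℝ] ℝ} {E : Module.Basis ι ℝ V} (hE : IsOrthonormalFor g E)
    (hp : ∀ v, v ≠ 0 → 0 < g v v) (B : V →L[ℝ] V →L[ℝ] ℝ) :
    formTrace g B = ∑ i, B (E i) (E i) := by
  simp [formTrace, hE.opTrace_eq, raise_spec hp]

theorem formTrace_add (g B B' : V →L[ℝ] V →L[ℝ] ℝ) :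
    formTrace g (B + B') = formTrace g B + formTrace g B' := by
  simp [formTrace, raise, ContinuousLinearMap.comp_add]

theorem formTrace_sub (g B B' : V →L[ℝ] V →L[ℝ] ℝ) :
    formTrace g (B - B') = formTrace g B - formTrace g B' := by
  simp [formTrace, raise, ContinuousLinearMap.comp_sub]

theorem formTrace_smul (g B : V →L[ℝ] V →L[ℝ] ℝ) (c : ℝ) :
    formTrace g (c • B) = c * formTrace g B := by
  simp [formTrace, raise]

theorem formTrace_self {g : V →L[ℝ] V →L[ℝ] ℝ} (hp : ∀ v, v ≠ 0 → 0 < g v v) :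
    formTrace g g = Module.finrank ℝ V := by
  rw [formTrace, raise_eq hp (P := 1) (fun v w => rfl), opTrace_one]

theorem contDiffOn_raise {U : Set V} {g B : V → V →L[ℝ] V →L[ℝ] ℝ}
    (hg : ContDiffOn ℝ ∞ g U) (hB : ContDiffOn ℝ ∞ B U)
    (hp : ∀ y ∈ U, ∀ v, v ≠ 0 → 0 < g y v v) :
    ContDiffOn ℝ ∞ (fun z => raise (g z) (B z)) U := by
  have := FiniteDimensional.complete ℝ V
  refine ContDiffOn.clm_comp (fun y hy => ?_) hB
  exact ((isInvertible_of_pos (hp y hy)).contDiffAt_map_inverse).comp_contDiffWithinAt y (hg y hy)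

/-- The metric trace commutes with covariant derivatives of a metric connection. -/
theorem fderiv_formTrace {U : Set V} (hU : IsOpen U) {g B : V → V →L[ℝ] V →L[ℝ] ℝ}
    {Γ : V → V →L[ℝ] V →L[ℝ] V}
    (hg : ContDiffOn ℝ ∞ g U) (hB : ContDiffOn ℝ ∞ B U)
    (hp : ∀ y ∈ U, ∀ v, v ≠ 0 → 0 < g y v v)
    (hmet : ∀ y ∈ U, ∀ u v w, fderiv ℝ g y u v w = g y (Γ y u v) w + g y v (Γ y u w))
    {y : V} (hy : y ∈ U) (u : V) :
    fderiv ℝ (fun z => formTrace (g z) (B z)) y u = formTrace (g y) (covBilin Γ B y u) := by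
  have dg := ContDiffOn.differentiableAt_of_isOpen hU hg hy
  have dB := ContDiffOn.differentiableAt_of_isOpen hU hB hy
  have dP := ContDiffOn.differentiableAt_of_isOpen hU (contDiffOn_raise hg hB hp) hy
  -- Raising an index commutes with ∇̂ because g is parallel; the trace then commutes by
  -- `opTrace_covEnd`.
  have key : raise (g y) (covBilin Γ B y u) = covEnd Γ (fun z => raise (g z) (B z)) y u := by
    refine raise_eq (hp y hy) fun v w => ?_
    have h1 := fderiv_congr_of_isOpen hU
      (fun z hz => raise_spec (hp z hz) (B z) v w) hy
    have h2 := congrArg (fun A => A u) h1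
    have dPv := dP.clm_apply (differentiableAt_const v)
    simp only [fderiv_apply_const₂ dB] at h2
    rw [fderiv_apply_const (dg.clm_apply dPv), fderiv_clm_apply dg dPv] at h2
    simp only [add_apply, ContinuousLinearMap.comp_apply, ContinuousLinearMap.flip_apply,
      fderiv_apply_const dP, hmet y hy, raise_spec (hp y hy)] at h2
    simp only [covEnd, covBilin_apply, add_apply, sub_apply, mul_apply_eq_comp, map_add,
      map_sub, raise_spec (hp y hy)]
    linarith
  rw [formTrace, key, opTrace_covEnd dP]
  rfl

/-- The bilinear form `(v, w) ↦ tr (P_v Q_w)`. -/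
def tracePair (P Q : V →L[ℝ] V →L[ℝ] V) : V →L[ℝ] V →L[ℝ] ℝ :=
  ((ContinuousLinearMap.compL ℝ (V →L[ℝ] V) (V →L[ℝ] V) ℝ opTrace).comp
    (ContinuousLinearMap.mul ℝ (V →L[ℝ] V))).bilinearComp P Q

theorem tracePair_apply (P Q : V →L[ℝ] V →L[ℝ] V) (v w : V) :
    tracePair P Q v w = opTrace (P v * Q w) := rfl

theorem contDiffOn_tracePair {U : Set V} {P Q : V → V →L[ℝ] V →L[ℝ] V}
    (hP : ContDiffOn ℝ ∞ P U) (hQ : ContDiffOn ℝ ∞ Q U) :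
    ContDiffOn ℝ ∞ (fun z => tracePair (P z) (Q z)) U := by
  rw [contDiffOn_clm_apply]
  intro v
  rw [contDiffOn_clm_apply]
  intro w
  exact opTrace.contDiff.comp_contDiffOn
    ((hP.clm_apply contDiffOn_const).mul (hQ.clm_apply contDiffOn_const))

end Metric

set_option maxSynthPendingDepth 3

section Statistical

variable {V : Type*} [NormedAddCommGroup V] [NormedSpace ℝ V]

/-! ### Statistical structures in a coordinate domain -/

/-- A Riemannian metric `g` with its Levi-Civita connection `Γ` and a `g`-symmetric difference
tensor `K` on an open set `U`. -/
structure StatisticalField (U : Set V) (g : V → V →L[ℝ] V →L[ℝ] ℝ)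
    (Γ K : V → V →L[ℝ] V →L[ℝ] V) : Prop where
  isOpen : IsOpen U
  smooth_metric : ContDiffOn ℝ ∞ g U
  smooth_connection : ContDiffOn ℝ ∞ Γ U
  smooth_tensor : ContDiffOn ℝ ∞ K U
  symm : ∀ y ∈ U, ∀ v w, g y v w = g y w v
  pos : ∀ y ∈ U, ∀ v, v ≠ 0 → 0 < g y v v
  torsion_free : ∀ y ∈ U, ∀ u v, Γ y u v = Γ y v u
  metric : ∀ y ∈ U, ∀ u v w, fderiv ℝ g y u v w = g y (Γ y u v) w + g y v (Γ y u w)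
  tensor_symm : ∀ y ∈ U, ∀ u v, K y u v = K y v u
  tensor_selfAdjoint : ∀ y ∈ U, ∀ u v w, g y (K y u v) w = g y v (K y u w)

namespace StatisticalField

variable {U : Set V} {g : V → V →L[ℝ] V →L[ℝ] ℝ} {Γ K : V → V →L[ℝ] V →L[ℝ] V}
  (hS : StatisticalField U g Γ K) {y : V} (hy : y ∈ U)

include hS hy

theorem differentiableAt_metric : DifferentiableAt ℝ g y :=
  ContDiffOn.differentiableAt_of_isOpen hS.isOpen hS.smooth_metric hy

theorem differentiableAt_connection : DifferentiableAt ℝ Γ y :=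
  ContDiffOn.differentiableAt_of_isOpen hS.isOpen hS.smooth_connection hy

theorem differentiableAt_tensor : DifferentiableAt ℝ K y :=
  ContDiffOn.differentiableAt_of_isOpen hS.isOpen hS.smooth_tensor hy

/-- Differentiating a metric pairing of two vector fields. -/
theorem fderiv_pairing {X Y : V → V} (hX : DifferentiableAt ℝ X y) (hY : DifferentiableAt ℝ Y y)
    (u : V) : fderiv ℝ (fun z => g z (X z) (Y z)) y u =
      g y (fderiv ℝ X y u + Γ y u (X y)) (Y y) + g y (X y) (fderiv ℝ Y y u + Γ y u (Y y)) := by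
  have dg := hS.differentiableAt_metric hy
  rw [fderiv_clm_apply (dg.clm_apply hX) hY, fderiv_clm_apply dg hX]
  simp only [add_apply, ContinuousLinearMap.comp_apply, ContinuousLinearMap.flip_apply,
    hS.metric y hy, map_add]
  ring

theorem covEnd_selfAdjoint {P : V → V →L[ℝ] V} (hP : DifferentiableAt ℝ P y)
    (h : ∀ z ∈ U, ∀ v w, g z (P z v) w = g z v (P z w)) (u v w : V) :
    g y (covEnd Γ P y u v) w = g y v (covEnd Γ P y u w) := by
  have h1 := fderiv_congr_of_isOpen hS.isOpen (fun z hz => h z hz v w) hy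
  have h2 := congrArg (fun A => A u) h1
  simp only [hS.fderiv_pairing hy (hP.clm_apply (differentiableAt_const v))
    (differentiableAt_const w), hS.fderiv_pairing hy (differentiableAt_const v)
    (hP.clm_apply (differentiableAt_const w)), fderiv_apply_const hP, fderiv_fun_const,
    Pi.zero_apply, zero_apply, zero_add] at h2
  have h3 := h y hy v (Γ y u w)
  have h4 := h y hy (Γ y u v) w
  simp only [covEnd, add_apply, sub_apply, mul_apply_eq_comp, map_add, map_sub] at h2 ⊢
  linarith

/-- The curvature of a metric connection is skew-symmetric. -/
theorem curvEnd_skew (s u v w : V) :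
    g y (curvEnd Γ y s u v) w = - g y v (curvEnd Γ y s u w) := by
  have dΓ := hS.differentiableAt_connection hy
  have dg' := ContDiffOn.differentiableAt_of_isOpen hS.isOpen
    (ContDiffOn.fderiv_infty hS.isOpen hS.smooth_metric) hy
  have hc : ∀ x : V, DifferentiableAt ℝ (fun _ : V => x) y := fun x => differentiableAt_const x
  -- The metric condition differentiated once more. The left side is symmetric in s and u, as are
  -- the mixed products of two Γ's taken together, so antisymmetrising leaves only curvature.
  have key : ∀ s u, fderiv ℝ (fderiv ℝ g) y s u v w =
      g y (fderiv ℝ Γ y s u v + Γ y s (Γ y u v)) w + g y (Γ y u v) (Γ y s w) +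
      (g y (Γ y s v) (Γ y u w) + g y v (fderiv ℝ Γ y s u w + Γ y s (Γ y u w))) := by
    intro s u
    have dX : ∀ v, DifferentiableAt ℝ (fun z => Γ z u v) y := fun v =>
      (dΓ.clm_apply (hc u)).clm_apply (hc v)
    have h1 := fderiv_congr_of_isOpen hS.isOpen (fun z hz => hS.metric z hz u v w) hy
    have h2 := congrArg (fun A => A s) h1
    have dg := hS.differentiableAt_metric hy
    rw [fderiv_apply_const₂ (dg'.clm_apply (hc u)), fderiv_apply_const dg',
      fderiv_fun_add ((dg.clm_apply (dX v)).clm_apply (hc w))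
        ((dg.clm_apply (hc v)).clm_apply (dX w)), add_apply,
      hS.fderiv_pairing hy (dX v) (hc w), hS.fderiv_pairing hy (hc v) (dX w)] at h2
    simpa only [fderiv_apply_const₂ dΓ, fderiv_fun_const,
      Pi.zero_apply, zero_apply, zero_add] using h2
  have e := fderiv_fderiv_symm hS.isOpen hS.smooth_metric hy s u
  have e' := congrArg (fun A => A v w) e
  simp only [key] at e'
  simp only [curvEnd, add_apply, sub_apply, mul_apply_eq_comp, map_add, map_sub] at e' ⊢
  linarith

/-- Together with `covForm_selfAdjoint` and the Codazzi symmetry this makes ∇̂K totally symmetric.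
-/
theorem covForm_apply_symm (u v w : V) : covForm Γ K y u v w = covForm Γ K y u w v := by
  have dK := hS.differentiableAt_tensor hy
  have h1 := fderiv_congr_of_isOpen hS.isOpen (fun z hz => hS.tensor_symm z hz v w) hy
  have h2 := congrArg (fun A => A u) h1
  simp only [fderiv_apply_const₂ dK] at h2
  simp only [covForm_apply, add_apply, sub_apply, mul_apply_eq_comp]
  rw [h2, hS.tensor_symm y hy v w, hS.tensor_symm y hy w (Γ y u v), hS.tensor_symm y hy v (Γ y u w)]
  abel

theorem covForm_selfAdjoint (u v w x : V) :
    g y (covForm Γ K y u v w) x = g y w (covForm Γ K y u v x) := by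
  have dK := hS.differentiableAt_tensor hy
  rw [covForm_eq dK, sub_apply, sub_apply, map_sub, map_sub, sub_apply,
    hS.covEnd_selfAdjoint hy (dK.clm_apply (differentiableAt_const v))
      (fun z hz => hS.tensor_selfAdjoint z hz v), hS.tensor_selfAdjoint y hy]

theorem differentiableAt_covForm [FiniteDimensional ℝ V] (u : V) :
    DifferentiableAt ℝ (fun z => covForm Γ K z u) y :=
  ContDiffOn.differentiableAt_of_isOpen hS.isOpen
    (contDiffOn_covForm hS.isOpen hS.smooth_connection hS.smooth_tensor u) hy

variable [FiniteDimensional ℝ V]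

theorem covForm₂_selfAdjoint (s u v w x : V) :
    g y (covForm₂ Γ K y s u v w) x = g y w (covForm₂ Γ K y s u v x) := by
  simp only [covForm₂, sub_apply, map_sub,
    hS.covEnd_selfAdjoint hy ((hS.differentiableAt_covForm hy u).clm_apply
      (differentiableAt_const v)) (fun z hz => hS.covForm_selfAdjoint hz u v),
    hS.covForm_selfAdjoint hy]

theorem covForm₂_apply_symm (s u v w : V) :
    covForm₂ Γ K y s u v w = covForm₂ Γ K y s u w v := by
  have dD := hS.differentiableAt_covForm hy u
  have h1 := fderiv_congr_of_isOpen hS.isOpen (fun z hz => hS.covForm_apply_symm hz u v w) hy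
  have h2 := congrArg (fun A => A s) h1
  simp only [fderiv_apply_const₂ dD] at h2
  simp only [covForm₂, covEnd, fderiv_apply_const dD, add_apply, sub_apply, mul_apply_eq_comp]
  rw [h2, hS.covForm_apply_symm hy u v w, hS.covForm_apply_symm hy u v (Γ y s w),
    hS.covForm_apply_symm hy _ v w, hS.covForm_apply_symm hy u (Γ y s v) w]
  abel

theorem covForm₂_symm (hcod : ∀ y ∈ U, ∀ u v, covForm Γ K y u v = covForm Γ K y v u)
    (s u v : V) : covForm₂ Γ K y s u v = covForm₂ Γ K y s v u := by
  have h1 := fderiv_congr_of_isOpen hS.isOpen (fun z hz => hcod z hz u v) hy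
  simp only [covForm₂, covEnd]
  rw [h1, hcod y hy u v, hcod y hy (Γ y s u), hcod y hy u (Γ y s v)]
  abel

theorem opTrace_covForm₂ (hτ : ∀ y ∈ U, ∀ u v, opTrace (covForm Γ K y u v) = 0) (s u v : V) :
    opTrace (covForm₂ Γ K y s u v) = 0 := by
  rw [covForm₂, map_sub, map_sub, opTrace_covEnd ((hS.differentiableAt_covForm hy u).clm_apply
    (differentiableAt_const v)), hτ y hy, hτ y hy,
    fderiv_congr_of_isOpen hS.isOpen (fun z hz => hτ z hz u v) hy]
  simp

/-- The Leibniz rule for the pairing tr(P_v Q_w); its two uses are the first and second derivatives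
of |K|². -/
theorem covBilin_tracePair {P Q : V → V →L[ℝ] V →L[ℝ] V} (hP : ContDiffOn ℝ ∞ P U)
    (hQ : ContDiffOn ℝ ∞ Q U) (s v w : V) :
    covBilin Γ (fun z => tracePair (P z) (Q z)) y s v w =
      opTrace (covForm Γ P y s v * Q y w) + opTrace (P y v * covForm Γ Q y s w) := by
  have dP := ContDiffOn.differentiableAt_of_isOpen hS.isOpen hP hy
  have dQ := ContDiffOn.differentiableAt_of_isOpen hS.isOpen hQ hy
  have dPv := dP.clm_apply (differentiableAt_const v)
  have dQw := dQ.clm_apply (differentiableAt_const w)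
  have dPQ := ContDiffOn.differentiableAt_of_isOpen hS.isOpen (contDiffOn_tracePair hP hQ) hy
  have h1 := opTrace_covEnd (Γ := Γ) (dPv.fun_mul dQw) s
  rw [covEnd_mul dPv dQw] at h1
  rw [covBilin_apply, ← fderiv_apply_const₂ dPQ]
  simp only [tracePair_apply]
  rw [← h1, covForm_eq dP, covForm_eq dQ, sub_mul, mul_sub, map_sub, map_sub, map_add]
  ring

theorem exists_basis : ∃ E : Module.Basis (Fin (Module.finrank ℝ V)) ℝ V,
    IsOrthonormalFor (g y) E :=
  exists_isOrthonormalFor (g y) (hS.symm y hy) (hS.pos y hy)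

end StatisticalField

end Statistical

section Rigidity

variable {V : Type*} [NormedAddCommGroup V] [NormedSpace ℝ V] [FiniteDimensional ℝ V]

/-! ### Ricci curvature and the local rigidity theorem -/

/-- The endomorphism `u ↦ R(u, v)w`. -/
def ricciOp (Γ : V → V →L[ℝ] V →L[ℝ] V) (y v w : V) : V →L[ℝ] V :=
  LinearMap.toContinuousLinearMap
    { toFun := fun u => curvEnd Γ y u v w
      map_add' := fun a b => by
        simp only [curvEnd, map_add, add_mul, mul_add, add_apply, sub_apply]
        abel
      map_smul' := fun r a => by
        simp only [curvEnd, map_smul, smul_mul_assoc, mul_smul_comm, add_apply, sub_apply,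
          smul_apply, RingHom.id_apply, smul_add, smul_sub] }

theorem ricciOp_apply (Γ : V → V →L[ℝ] V →L[ℝ] V) (y u v w : V) :
    ricciOp Γ y v w u = curvEnd Γ y u v w := rfl

/-- The Ricci tensor, as a bilinear form. -/
def ricciForm (Γ : V → V →L[ℝ] V →L[ℝ] V) (y : V) : V →L[ℝ] V →L[ℝ] ℝ :=
  LinearMap.toContinuousBilinearMap <| LinearMap.mk₂ ℝ (fun v w => opTrace (ricciOp Γ y v w))
    (fun a b w => by
      rw [← map_add]; congr 1; ext u
      simp only [ricciOp_apply, curvEnd, map_add, add_mul, mul_add, add_apply, sub_apply]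
      abel)
    (fun r a w => by
      rw [← map_smul]; congr 1; ext u
      simp only [ricciOp_apply, curvEnd, map_smul, smul_mul_assoc, mul_smul_comm, add_apply,
        sub_apply, smul_apply, smul_add, smul_sub])
    (fun v a b => by
      rw [← map_add]; congr 1; ext u
      simp only [ricciOp_apply, map_add, add_apply])
    (fun r v a => by
      rw [← map_smul]; congr 1; ext u
      simp only [ricciOp_apply, map_smul, smul_apply])

theorem ricciForm_apply (Γ : V → V →L[ℝ] V →L[ℝ] V) (y v w : V) :
    ricciForm Γ y v w = opTrace (ricciOp Γ y v w) := rfl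

/-- The bilinear form `(v, w) ↦ tr K(K(v, w))`. -/
def traceSquare (K : V →L[ℝ] V →L[ℝ] V) : V →L[ℝ] V →L[ℝ] ℝ :=
  (ContinuousLinearMap.compL ℝ V V ℝ (opTrace.comp K)).comp K

theorem traceSquare_apply (K : V →L[ℝ] V →L[ℝ] V) (v w : V) :
    traceSquare K v w = opTrace (K (K v w)) := rfl

theorem contDiffOn_traceSquare {U : Set V} {K : V → V →L[ℝ] V →L[ℝ] V}
    (hK : ContDiffOn ℝ ∞ K U) : ContDiffOn ℝ ∞ (fun z => traceSquare (K z)) U := by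
  rw [contDiffOn_clm_apply]
  intro v
  rw [contDiffOn_clm_apply]
  intro w
  exact opTrace.contDiff.comp_contDiffOn (hK.clm_apply
    ((hK.clm_apply contDiffOn_const).clm_apply contDiffOn_const))

theorem contDiffOn_formTrace {U : Set V} {g B : V → V →L[ℝ] V →L[ℝ] ℝ}
    (hg : ContDiffOn ℝ ∞ g U) (hB : ContDiffOn ℝ ∞ B U)
    (hp : ∀ y ∈ U, ∀ v, v ≠ 0 → 0 < g y v v) :
    ContDiffOn ℝ ∞ (fun z => formTrace (g z) (B z)) U :=
  (opTrace (V := V)).contDiff.comp_contDiffOn (contDiffOn_raise hg hB hp)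

namespace StatisticalField

variable {U : Set V} {g : V → V →L[ℝ] V →L[ℝ] ℝ} {Γ K : V → V →L[ℝ] V →L[ℝ] V} {H : V → ℝ}
  (hS : StatisticalField U g Γ K)
  (hcod : ∀ y ∈ U, ∀ u v, covForm Γ K y u v = covForm Γ K y v u)
  (hgauss : ∀ y ∈ U, ∀ s a,
    curvEnd Γ y s a = H y • wedgeOp (g y) s a - (K y s * K y a - K y a * K y s))
  (hτ : ∀ y ∈ U, ∀ u v, opTrace (covForm Γ K y u v) = 0)

include hS

-- The Gauss equation contracted: symmetry of K exhibits R(u, v)w as an explicit endomorphism of u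
-- whose trace can be read off.
include hgauss in
theorem ricciForm_eq {y : V} (hy : y ∈ U) :
    ricciForm Γ y = ((Module.finrank ℝ V - 1 : ℝ) * H y) • g y - traceSquare (K y)
      + tracePair (K y) (K y) := by
  obtain ⟨E, hE⟩ := hS.exists_basis hy
  ext v w
  -- The factor `1 *` puts the rank-one term in the form needed by `opTrace_mul_smulRight`.
  have e : ricciOp Γ y v w = H y • (g y v w • 1 - 1 * (g y w).smulRight v)
      - (K y (K y v w) - K y v * K y w) := by
    ext u
    simp only [ricciOp_apply, hgauss y hy, wedgeOp, sub_apply, smul_apply, mul_apply_eq_comp,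
      ContinuousLinearMap.smulRight_apply, one_mul, hS.tensor_symm y hy u,
      hS.symm y hy u w, one_apply_eq_self]
  simp only [ricciForm_apply, e, map_sub, map_smul, opTrace_one,
    hE.opTrace_mul_smulRight (hS.symm y hy), one_apply_eq_self, add_apply, sub_apply, smul_apply,
    traceSquare_apply, tracePair_apply, smul_eq_mul, hS.symm y hy w v]
  ring

-- The form is τ(K(v, w)) with τ(x) = tr K_x. Since τ is parallel, the derivative falls only on the
-- inner K.
include hτ in
theorem covBilin_traceSquare {y : V} (hy : y ∈ U) (u v w : V) :
    covBilin Γ (fun z => traceSquare (K z)) y u v w = opTrace (K y (covForm Γ K y u v w)) := by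
  have dK := hS.differentiableAt_tensor hy
  have dKv := dK.clm_apply (differentiableAt_const v)
  have dKvw := dKv.clm_apply (differentiableAt_const w)
  have cT := contDiffOn_traceSquare hS.smooth_tensor
  have dT := ContDiffOn.differentiableAt_of_isOpen hS.isOpen cT hy
  have h1 := opTrace_covEnd (Γ := Γ) (dK.clm_apply dKvw) u
  have h2 := hτ y hy u (K y v w)
  rw [covForm_apply, map_sub] at h2
  rw [covBilin_apply, ← fderiv_apply_const₂ dT]
  simp only [traceSquare_apply]
  rw [← h1, covEnd, fderiv_clm_apply dK dKvw, fderiv_clm_apply dKv (differentiableAt_const w),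
    covForm_apply]
  simp only [add_apply, sub_apply, mul_apply_eq_comp, ContinuousLinearMap.comp_apply,
    ContinuousLinearMap.flip_apply, fderiv_apply_const dK, map_add, map_sub, fderiv_fun_const,
    Pi.zero_apply, zero_apply, map_zero, zero_add] at h2 ⊢
  linarith

-- Up to a factor 2 the left side is the derivative of |K|². In the scalar curvature the H term has
-- zero derivative by `hH'`, and the |τ|² term by the vanishing contraction of ∇̂K, so |K|² must be
-- constant.
include hgauss hcod hτ in
theorem formTrace_tracePair_eq_zero
    (hH : ∀ y ∈ U, DifferentiableAt ℝ H y)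
    (hH' : ∀ y ∈ U, ∀ u, (Module.finrank ℝ V - 1 : ℝ) * fderiv ℝ H y u = 0)
    {c : ℝ} (hρ : ∀ y ∈ U, formTrace (g y) (ricciForm Γ y) = c) {y : V} (hy : y ∈ U) (u : V) :
    formTrace (g y) (tracePair (covForm Γ K y u) (K y)) = 0 := by
  obtain ⟨E, hE⟩ := hS.exists_basis hy
  have hp := hS.pos y hy
  have cK := hS.smooth_tensor
  have cT := contDiffOn_traceSquare hS.smooth_tensor
  have cB := contDiffOn_tracePair cK cK
  have trd : ∀ {B : V → V →L[ℝ] V →L[ℝ] ℝ}, ContDiffOn ℝ ∞ B U →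
      DifferentiableAt ℝ (fun z => formTrace (g z) (B z)) y ∧
      fderiv ℝ (fun z => formTrace (g z) (B z)) y u = formTrace (g y) (covBilin Γ B y u) :=
    fun hB => ⟨ContDiffOn.differentiableAt_of_isOpen hS.isOpen
        (contDiffOn_formTrace hS.smooth_metric hB hS.pos) hy,
      fderiv_formTrace hS.isOpen hS.smooth_metric hB hS.pos hS.metric hy u⟩
  obtain ⟨dT, eT⟩ := trd cT
  obtain ⟨dB, eB⟩ := trd cB
  have h0 : ∀ z ∈ U, (Module.finrank ℝ V : ℝ) * (Module.finrank ℝ V - 1) * H z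
      - formTrace (g z) (traceSquare (K z)) + formTrace (g z) (tracePair (K z) (K z)) = c := by
    intro z hz
    rw [← hρ z hz, hS.ricciForm_eq hgauss hz, formTrace_add, formTrace_sub, formTrace_smul,
      formTrace_self (hS.pos z hz)]
    ring
  have h1 := congrArg (fun A => A u) (fderiv_congr_of_isOpen hS.isOpen h0 hy)
  simp only [fderiv_fun_const, Pi.zero_apply, zero_apply] at h1
  have dH := (hH y hy).const_mul ((Module.finrank ℝ V : ℝ) * (Module.finrank ℝ V - 1))
  rw [fderiv_fun_add (dH.fun_sub dT) dB, fderiv_fun_sub dH dT, add_apply, sub_apply, eT, eB,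
    fderiv_const_mul (hH y hy), smul_apply, smul_eq_mul, mul_assoc, hH' y hy, mul_zero,
    hE.formTrace_eq hp, hE.formTrace_eq hp] at h1
  simp only [hS.covBilin_traceSquare hτ hy, hS.covBilin_tracePair hy cK cK] at h1
  have h2 : ∑ i, covForm Γ K y u (E i) (E i) = 0 := by
    have h3 := hE.sum_diag_eq_zero hp (hcod y hy) (hS.covForm_apply_symm hy)
      (hS.covForm_selfAdjoint hy) (hτ y hy)
    have h4 := congrArg (fun A => A u) h3
    simp only [sum_apply, zero_apply] at h4
    rw [← h4]
    refine Finset.sum_congr rfl fun i _ => ?_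
    rw [hcod y hy u, hS.covForm_apply_symm hy]
  rw [← map_sum, ← map_sum, h2, map_zero, map_zero] at h1
  rw [hE.formTrace_eq hp]
  simp only [opTrace_mul_comm (K y _), ← two_mul, ← Finset.mul_sum] at h1
  simp only [tracePair_apply]
  linarith

include hgauss hcod hτ in
/-- Local rigidity: the difference tensor is parallel and the metric is flat. -/
theorem rigidity
    (hH : ∀ y ∈ U, DifferentiableAt ℝ H y)
    (hH' : ∀ y ∈ U, ∀ u, (Module.finrank ℝ V - 1 : ℝ) * fderiv ℝ H y u = 0)
    (hH0 : ∀ y ∈ U, H y ≤ 0)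
    (hRic : ∀ y ∈ U, ∀ v, 0 ≤ opTrace (ricciOp Γ y v v))
    {c : ℝ} (hρ : ∀ y ∈ U, formTrace (g y) (ricciForm Γ y) = c) {y : V} (hy : y ∈ U) :
    (∀ u v, covForm Γ K y u v = 0) ∧ (∀ u v, curvEnd Γ y u v = 0) := by
  obtain ⟨E, hE⟩ := hS.exists_basis hy
  have hp := hS.pos y hy
  have cD := contDiffOn_covForm hS.isOpen hS.smooth_connection hS.smooth_tensor
  have hq := fun y hy u =>
    hS.formTrace_tracePair_eq_zero hcod hgauss hτ hH hH' hρ (y := y) hy u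
  have hlap : ∀ s u, ∑ a, (opTrace (covForm₂ Γ K y s u (E a) * K y (E a)) +
      opTrace (covForm Γ K y u (E a) * covForm Γ K y s (E a))) = 0 := by
    intro s u
    have h1 := fderiv_formTrace hS.isOpen hS.smooth_metric
      (contDiffOn_tracePair (cD u) hS.smooth_tensor) hS.pos hS.metric hy s
    rw [fderiv_congr_of_isOpen hS.isOpen (fun z hz => hq z hz u) hy, hE.formTrace_eq hp] at h1
    have h2 := hq y hy (Γ y s u)
    rw [hE.formTrace_eq hp] at h2
    -- Here u is frozen as a constant vector field, so differentiating yields ∇̂²_{s,u}K plus ∇̂K in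
    -- the direction Γ_s u. The latter pairs to zero with K by `hq` in that direction.
    have h3 : ∀ v, covForm Γ (fun z => covForm Γ K z u) y s v =
        covForm₂ Γ K y s u v + covForm Γ K y (Γ y s u) v := by
      intro v
      rw [covForm₂, covForm_eq (hS.differentiableAt_covForm hy u)]
      abel
    simp only [hS.covBilin_tracePair hy (cD u) hS.smooth_tensor, h3, add_mul, map_add,
      Finset.sum_add_distrib, fderiv_fun_const, Pi.zero_apply, zero_apply,
      tracePair_apply] at h1 h2 ⊢
    linarith
  have main := hE.bochner (K := K y) (D := fun u v => covForm Γ K y u v) (D₂ := covForm₂ Γ K y)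
    (R := curvEnd Γ y) (H := H y) (hS.symm y hy) hp (hS.tensor_symm y hy)
    (hS.tensor_selfAdjoint y hy) (hS.covForm_selfAdjoint hy)
    (hS.covForm₂_symm hy hcod) (hS.covForm₂_apply_symm hy) (hS.covForm₂_selfAdjoint hy)
    (hS.opTrace_covForm₂ hy hτ) (hgauss y hy)
    (covForm₂_sub_swap hS.isOpen hS.smooth_connection hS.smooth_tensor hS.torsion_free hy)
    (hH0 y hy) (fun v => by simpa only [hE.opTrace_eq, ricciOp_apply] using hRic y hy v)
    (Finset.sum_eq_zero fun s _ => hlap _ _)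
  obtain ⟨h1, h2⟩ := main
  constructor
  · have e1 : ∀ s, covForm Γ K y (E s) = 0 := fun s =>
      ContinuousLinearMap.coe_injective (E.ext fun a => h1 s a)
    have e2 : ∀ u, covForm Γ K y u = 0 := fun u =>
      ContinuousLinearMap.coe_injective (E.ext fun a => by
        change covForm Γ K y u (E a) = 0
        rw [hcod y hy, e1, zero_apply])
    intro u v
    rw [e2, zero_apply]
  · have e1 : ∀ a w, ricciOp Γ y (E a) w = 0 := fun a w =>
      ContinuousLinearMap.coe_injective (E.ext fun s => by
        change curvEnd Γ y (E s) (E a) w = 0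
        rw [h2, zero_apply])
    have e2 : ∀ u v, curvEnd Γ y u v = - curvEnd Γ y v u := fun u v => by
      simp only [curvEnd]
      abel
    have e3 : ∀ u w, ricciOp Γ y u w = 0 := fun u w =>
      ContinuousLinearMap.coe_injective (E.ext fun a => by
        change curvEnd Γ y (E a) u w = 0
        rw [e2, neg_apply, ← ricciOp_apply, e1, zero_apply, neg_zero])
    intro u v
    ext w
    rw [← ricciOp_apply, e3, zero_apply, zero_apply]

end StatisticalField

end Rigidity

section Structure

variable {V : Type*} [NormedAddCommGroup V] [NormedSpace ℝ V]

/-! ### The Levi-Civita connection -/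

/-- The Koszul form `½ (∂_u g(v, ·) + ∂_v g(u, ·) - ∂ g(u, v))`. -/
def koszul (g : V → V →L[ℝ] V →L[ℝ] ℝ) (y u v : V) : V →L[ℝ] ℝ :=
  (1 / 2 : ℝ) • (fderiv ℝ g y u v + fderiv ℝ g y v u - ((fderiv ℝ g y).flip u).flip v)

theorem koszul_apply (g : V → V →L[ℝ] V →L[ℝ] ℝ) (y u v w : V) :
    koszul g y u v w =
      (1 / 2 : ℝ) * (fderiv ℝ g y u v w + fderiv ℝ g y v u w - fderiv ℝ g y w u v) := rfl

/-- The Levi-Civita connection of `g`. -/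
def leviCivitaForm [FiniteDimensional ℝ V] (g : V → V →L[ℝ] V →L[ℝ] ℝ) (y : V) :
    V →L[ℝ] V →L[ℝ] V :=
  LinearMap.toContinuousBilinearMap <| LinearMap.mk₂ ℝ
    (fun u v => (g y).inverse (koszul g y u v))
    (fun a b w => by
      rw [← map_add]; congr 1; ext x
      simp only [koszul_apply, map_add, add_apply]; ring)
    (fun r a w => by
      rw [← map_smul]; congr 1; ext x
      simp only [koszul_apply, map_smul, smul_apply, smul_eq_mul]; ring)
    (fun v a b => by
      rw [← map_add]; congr 1; ext x
      simp only [koszul_apply, map_add, add_apply]; ring)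
    (fun r v a => by
      rw [← map_smul]; congr 1; ext x
      simp only [koszul_apply, map_smul, smul_apply, smul_eq_mul]; ring)

theorem leviCivitaForm_apply [FiniteDimensional ℝ V] (g : V → V →L[ℝ] V →L[ℝ] ℝ) (y u v : V) :
    leviCivitaForm g y u v = (g y).inverse (koszul g y u v) := rfl

theorem leviCivitaForm_spec [FiniteDimensional ℝ V] {g : V → V →L[ℝ] V →L[ℝ] ℝ} {y : V}
    (hp : ∀ v, v ≠ 0 → 0 < g y v v) (u v w : V) :
    g y (leviCivitaForm g y u v) w = koszul g y u v w := by
  rw [leviCivitaForm_apply, (isInvertible_of_pos hp).self_apply_inverse]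

theorem contDiffOn_leviCivitaForm [FiniteDimensional ℝ V] {U : Set V} (hU : IsOpen U)
    {g : V → V →L[ℝ] V →L[ℝ] ℝ} (hg : ContDiffOn ℝ ∞ g U)
    (hp : ∀ y ∈ U, ∀ v, v ≠ 0 → 0 < g y v v) : ContDiffOn ℝ ∞ (leviCivitaForm g) U := by
  have := FiniteDimensional.complete ℝ V
  rw [contDiffOn_clm_apply]
  intro u
  rw [contDiffOn_clm_apply]
  intro v
  refine ContDiffOn.clm_apply (f := fun z => (g z).inverse) (g := fun z => koszul g z u v)
    (fun y hy => ?_) ?_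
  · exact ((isInvertible_of_pos (hp y hy)).contDiffAt_map_inverse).comp_contDiffWithinAt y
      (hg y hy)
  · rw [contDiffOn_clm_apply]
    intro w
    have h := ContDiffOn.fderiv_infty hU hg
    have h3 : ∀ a b c : V, ContDiffOn ℝ ∞ (fun z => fderiv ℝ g z a b c) U := fun a b c =>
      ((h.clm_apply contDiffOn_const).clm_apply contDiffOn_const).clm_apply contDiffOn_const
    exact contDiffOn_const.mul (((h3 u v w).add (h3 v u w)).sub (h3 w u v))

theorem fderiv_metric_symm {U : Set V} (hU : IsOpen U)
    {g : V → V →L[ℝ] V →L[ℝ] ℝ} (hg : ContDiffOn ℝ ∞ g U)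
    (hs : ∀ y ∈ U, ∀ v w, g y v w = g y w v) {y : V} (hy : y ∈ U) (u v w : V) :
    fderiv ℝ g y u v w = fderiv ℝ g y u w v := by
  have dg := ContDiffOn.differentiableAt_of_isOpen hU hg hy
  have h := congrArg (fun A => A u) (fderiv_congr_of_isOpen hU (fun z hz => hs z hz v w) hy)
  simpa only [fderiv_apply_const₂ dg] using h

/-- The difference tensor of a torsion-free connection satisfying the Codazzi equation and the
Levi-Civita connection is `g`-symmetric. -/
theorem statisticalField_of_codazzi [FiniteDimensional ℝ V] {U : Set V} (hU : IsOpen U)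
    {g : V → V →L[ℝ] V →L[ℝ] ℝ} {Γ' : V → V →L[ℝ] V →L[ℝ] V}
    (hg : ContDiffOn ℝ ∞ g U) (hΓ' : ContDiffOn ℝ ∞ Γ' U)
    (hs : ∀ y ∈ U, ∀ v w, g y v w = g y w v) (hp : ∀ y ∈ U, ∀ v, v ≠ 0 → 0 < g y v v)
    (ht : ∀ y ∈ U, ∀ u v, Γ' y u v = Γ' y v u)
    (hcod : ∀ y ∈ U, ∀ u v w, covBilin Γ' g y u v w = covBilin Γ' g y v u w) :
    StatisticalField U g (leviCivitaForm g) (fun y => Γ' y - leviCivitaForm g y) := by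
  have hgs := fun y hy => fderiv_metric_symm hU hg hs (y := y) hy
  have hlc : ∀ y ∈ U, ∀ u v, leviCivitaForm g y u v = leviCivitaForm g y v u := by
    intro y hy u v
    refine eq_of_forall_metric (hp y hy) fun w => ?_
    rw [leviCivitaForm_spec (hp y hy), leviCivitaForm_spec (hp y hy), koszul_apply, koszul_apply,
      hgs y hy w u v]
    ring
  refine ⟨hU, hg, contDiffOn_leviCivitaForm hU hg hp,
    hΓ'.sub (contDiffOn_leviCivitaForm hU hg hp), hs, hp, hlc, ?_, ?_, ?_⟩
  · intro y hy u v w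
    rw [leviCivitaForm_spec (hp y hy), hs y hy v, leviCivitaForm_spec (hp y hy), koszul_apply,
      koszul_apply, hgs y hy w u v, hgs y hy v u w, hgs y hy u w v]
    ring
  · intro y hy u v
    simp only [sub_apply, ht y hy u v, hlc y hy u v]
  -- By Koszul, selfadjointness of K_u reduces to g(Γ'_v u, w) - g(Γ'_w u, v) = ∂_v g(u, w) - ∂_w
  -- g(u, v). This is the Codazzi equation for (v, w, u) once the torsion terms cancel.
  · intro y hy u v w
    have h1 := hcod y hy v w u
    have e1 : g y w (Γ' y v u) = g y (Γ' y u v) w := by rw [ht y hy, hs y hy]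
    have e2 : g y v (Γ' y w u) = g y (Γ' y u w) v := by rw [ht y hy, hs y hy]
    rw [covBilin_apply, covBilin_apply, ht y hy w v, e1, e2] at h1
    simp only [sub_apply, map_sub, hs y hy v (Γ' y u w), hs y hy v (leviCivitaForm g y u w),
      leviCivitaForm_spec (hp y hy), koszul_apply]
    linarith [hgs y hy u v w, hgs y hy v u w, hgs y hy w u v]

/-! ### The equations of Gauss, Codazzi and Ricci -/

section Immersion

variable {W : Type*} [NormedAddCommGroup W] [NormedSpace ℝ W]

/-- The structure equations of a piece `F` of an equiaffine sphere with transversal field `ζ`. -/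
structure SphereEquations (U : Set V) (F ζ : V → W) (g : V → V →L[ℝ] V →L[ℝ] ℝ)
    (Γ' : V → V →L[ℝ] V →L[ℝ] V) (h : V → ℝ) : Prop where
  isOpen : IsOpen U
  smooth_map : ContDiffOn ℝ ∞ F U
  smooth_field : ContDiffOn ℝ ∞ ζ U
  smooth_form : ContDiffOn ℝ ∞ g U
  smooth_connection : ContDiffOn ℝ ∞ Γ' U
  smooth_curvature : ContDiffOn ℝ ∞ h U
  frame : ∀ y ∈ U, ∀ v (t : ℝ), fderiv ℝ F y v + t • ζ y = 0 → v = 0 ∧ t = 0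
  gauss : ∀ y ∈ U, ∀ u v, fderiv ℝ (fderiv ℝ F) y u v = fderiv ℝ F y (Γ' y u v) + g y u v • ζ y
  weingarten : ∀ y ∈ U, ∀ v, fderiv ℝ ζ y v = - h y • fderiv ℝ F y v

namespace SphereEquations

variable {U : Set V} {F ζ : V → W} {g : V → V →L[ℝ] V →L[ℝ] ℝ}
  {Γ' : V → V →L[ℝ] V →L[ℝ] V} {h : V → ℝ} (hE : SphereEquations U F ζ g Γ' h)
  {y : V} (hy : y ∈ U)

include hE hy

theorem frame_ext {v w : V} {s t : ℝ}
    (H : fderiv ℝ F y v + s • ζ y = fderiv ℝ F y w + t • ζ y) : v = w ∧ s = t := by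
  have := hE.frame y hy (v - w) (s - t) (by
    rw [map_sub, sub_smul, sub_add_sub_comm, H, sub_self])
  exact ⟨sub_eq_zero.1 this.1, sub_eq_zero.1 this.2⟩

theorem symm (u v : V) : Γ' y u v = Γ' y v u ∧ g y u v = g y v u :=
  hE.frame_ext hy (by
    rw [← hE.gauss y hy, ← hE.gauss y hy, fderiv_fderiv_symm hE.isOpen hE.smooth_map hy])

/-- Differentiate the Gauss formula and resubstitute Gauss and Weingarten, splitting the result into
tangential and transversal parts. -/
theorem third_derivative (w u v : V) :
    fderiv ℝ (fderiv ℝ (fderiv ℝ F)) y w u v =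
      fderiv ℝ F y (Γ' y w (Γ' y u v) + fderiv ℝ Γ' y w u v - (h y * g y u v) • w) +
      (g y w (Γ' y u v) + fderiv ℝ g y w u v) • ζ y := by
  have sF := ContDiffOn.fderiv_infty hE.isOpen hE.smooth_map
  have dF := ContDiffOn.differentiableAt_of_isOpen hE.isOpen sF hy
  have dF' := ContDiffOn.differentiableAt_of_isOpen hE.isOpen
    (ContDiffOn.fderiv_infty hE.isOpen sF) hy
  have dΓ := ContDiffOn.differentiableAt_of_isOpen hE.isOpen hE.smooth_connection hy
  have dg := ContDiffOn.differentiableAt_of_isOpen hE.isOpen hE.smooth_form hy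
  have dζ := ContDiffOn.differentiableAt_of_isOpen hE.isOpen hE.smooth_field hy
  have dΓ' := (dΓ.clm_apply (differentiableAt_const u)).clm_apply (differentiableAt_const v)
  have dg' := (dg.clm_apply (differentiableAt_const u)).clm_apply (differentiableAt_const v)
  have e := congrArg (fun A => A w)
    (fderiv_congr_of_isOpen hE.isOpen (fun z hz => hE.gauss z hz u v) hy)
  simp only [fderiv_apply_const₂ dF'] at e
  rw [e, fderiv_fun_add (dF.clm_apply dΓ') (dg'.fun_smul dζ), fderiv_clm_apply dF dΓ',
    fderiv_fun_smul dg' dζ]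
  simp only [add_apply, ContinuousLinearMap.comp_apply, ContinuousLinearMap.flip_apply,
    fderiv_apply_const₂ dΓ, fderiv_apply_const₂ dg, hE.gauss y hy, hE.weingarten y hy, smul_apply,
    ContinuousLinearMap.smulRight_apply, map_add, map_sub, map_smul]
  module

/-- The third derivative of F is symmetric in w and u: its tangential part gives the curvature, its
transversal part the Codazzi equation. -/
theorem gauss_codazzi (w u v : V) :
    (curvEnd Γ' y w u v = h y • wedgeOp (g y) w u v) ∧
    covBilin Γ' g y w u v = covBilin Γ' g y u w v := by
  have e := fderiv_fderiv_symm hE.isOpen (ContDiffOn.fderiv_infty hE.isOpen hE.smooth_map) hy w u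
  have e' := congrArg (fun A => A v) e
  simp only [hE.third_derivative hy] at e'
  obtain ⟨h1, h2⟩ := hE.frame_ext hy e'
  constructor
  · simp only [curvEnd, wedgeOp, add_apply, sub_apply, mul_apply_eq_comp,
      ContinuousLinearMap.smulRight_apply]
    rw [sub_eq_iff_eq_add] at h1
    have : Γ' y w (Γ' y u v) = Γ' y u (Γ' y w v) + fderiv ℝ Γ' y u w v - (h y * g y w v) • u
      + (h y * g y u v) • w - fderiv ℝ Γ' y w u v := by
      rw [← h1]; abel
    rw [this]
    module
  · simp only [covBilin_apply, (hE.symm hy u w).1, (hE.symm hy u (Γ' y w v)).2] at h2 ⊢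
    linarith [(hE.symm hy w (Γ' y u v)).2, (hE.symm hy u (Γ' y w v)).2]

/-- Symmetry of the second derivative of ζ, with ζ' = -h F'. The terms in F'' cancel. -/
theorem fderiv_curvature_smul (w v : V) : fderiv ℝ h y w • v = fderiv ℝ h y v • w := by
  have sF := ContDiffOn.fderiv_infty hE.isOpen hE.smooth_map
  have dF := ContDiffOn.differentiableAt_of_isOpen hE.isOpen sF hy
  have dh := ContDiffOn.differentiableAt_of_isOpen hE.isOpen hE.smooth_curvature hy
  have dζ := ContDiffOn.differentiableAt_of_isOpen hE.isOpen
    (ContDiffOn.fderiv_infty hE.isOpen hE.smooth_field) hy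
  have key : ∀ w v, fderiv ℝ (fderiv ℝ ζ) y w v =
      - fderiv ℝ h y w • fderiv ℝ F y v - h y • fderiv ℝ (fderiv ℝ F) y w v := by
    intro w v
    have e := congrArg (fun A => A w)
      (fderiv_congr_of_isOpen hE.isOpen (fun z hz => hE.weingarten z hz v) hy)
    simp only [fderiv_apply_const dζ] at e
    rw [e, fderiv_fun_smul dh.fun_neg (dF.clm_apply (differentiableAt_const v))]
    simp only [add_apply, smul_apply, ContinuousLinearMap.smulRight_apply, fderiv_fun_neg,
      fderiv_apply_const dF, neg_apply]
    module
  have e := fderiv_fderiv_symm hE.isOpen hE.smooth_field hy w v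
  rw [key, key, fderiv_fderiv_symm hE.isOpen hE.smooth_map hy v w, sub_left_inj, neg_smul,
    neg_smul, neg_inj, ← map_smul, ← map_smul] at e
  exact (hE.frame_ext hy (s := 0) (t := 0) (by rw [e])).1

end SphereEquations

end Immersion

end Structure

section Coordinates

variable {n : ℕ}

/-! ### Coordinate expressions -/

theorem sum_coord_smul (x : Rn n) : ∑ i, x i • coordVec i = x := by
  have := (EuclideanSpace.basisFun (Fin n) ℝ).sum_repr x
  simpa [coordVec] using this

theorem opTrace_eq_sum_coord (P : Rn n →L[ℝ] Rn n) : opTrace P = ∑ i, P (coordVec i) i := by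
  rw [opTrace_apply, LinearMap.trace_eq_matrix_trace ℝ (EuclideanSpace.basisFun (Fin n) ℝ).toBasis,
    Matrix.trace]
  refine Finset.sum_congr rfl fun i _ => ?_
  simp [LinearMap.toMatrix_apply, coordVec]

/-- The bridge from inverse-matrix formulas to coordinate-free index raising, used for both metric
traces and Christoffel symbols. -/
theorem sum_inverseMetric_mul {g : Rn n → Rn n → Rn n → ℝ} {y : Rn n}
    {G : Rn n →L[ℝ] Rn n →L[ℝ] ℝ} (hG : ∀ v w, g y v w = G v w)
    (hs : ∀ v w, G v w = G w v) (hp : ∀ v, v ≠ 0 → 0 < G v v) (x : Rn n) (i : Fin n) :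
    ∑ j, inverseMetric g y i j * G x (coordVec j) = x i := by
  set A : Matrix (Fin n) (Fin n) ℝ := Matrix.of fun i j => g y (coordVec i) (coordVec j) with hA
  have hmul : ∀ x : Rn n, A.mulVec (fun k => x k) = fun j => G x (coordVec j) := by
    intro x
    ext j
    conv_rhs => rw [← sum_coord_smul x]
    simp only [map_sum, sum_apply, map_smul, smul_apply, smul_eq_mul, Matrix.mulVec, dotProduct,
      hA, Matrix.of_apply, hG]
    exact Finset.sum_congr rfl fun k _ => by rw [hs, mul_comm]
  -- A kernel vector v of the Gram matrix would satisfy G(v, v) = 0.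
  have hdet : IsUnit A.det := by
    rw [isUnit_iff_ne_zero]
    intro h0
    obtain ⟨v, hv, hv0⟩ := Matrix.exists_mulVec_eq_zero_iff.2 h0
    have h1 := hmul (WithLp.toLp 2 v)
    have h2 : ∀ j, G (WithLp.toLp 2 v) (coordVec j) = 0 := fun j => by
      rw [← congrFun h1 j]
      exact congrFun hv0 j
    have hv' : (WithLp.toLp 2 v : Rn n) ≠ 0 := fun h => hv (by
      ext k
      exact congrArg (fun z : Rn n => z k) h)
    refine (hp _ hv').ne' ?_
    conv_lhs => rw [← sum_coord_smul (WithLp.toLp 2 v : Rn n)]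
    rw [map_sum]
    refine Finset.sum_eq_zero fun k _ => ?_
    rw [sum_coord_smul, map_smul, h2, smul_zero]
  have h3 : (A⁻¹).mulVec (A.mulVec (fun k => x k)) i = x i := by
    rw [Matrix.mulVec_mulVec, Matrix.nonsing_inv_mul _ hdet, Matrix.one_mulVec]
  rw [hmul] at h3
  exact h3

theorem metricTrace_eq {g : Rn n → Rn n → Rn n → ℝ} {y : Rn n}
    {G : Rn n →L[ℝ] Rn n →L[ℝ] ℝ} (hG : ∀ v w, g y v w = G v w)
    (hs : ∀ v w, G v w = G w v) (hp : ∀ v, v ≠ 0 → 0 < G v v) {B : Rn n → Rn n → ℝ}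
    {P : Rn n →L[ℝ] Rn n} (hB : ∀ v w, B v w = G (P v) w) :
    metricTrace g y B = opTrace P := by
  rw [opTrace_eq_sum_coord, metricTrace]
  refine Finset.sum_congr rfl fun i _ => ?_
  simp only [hB]
  exact sum_inverseMetric_mul hG hs hp _ i

/-! ### The forms of a parametrized hypersurface as continuous multilinear fields -/

/-- The second fundamental form, as a field of continuous bilinear forms. -/
def secondFormField (F ζ : Rn n → Rn (n + 1)) (y : Rn n) : Rn n →L[ℝ] Rn n →L[ℝ] ℝ :=
  (ContinuousLinearMap.compL ℝ (Rn n) (Rn (n + 1)) ℝ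
    ((ContinuousLinearMap.snd ℝ (Rn n) ℝ).comp (gaussFrame F ζ y).inverse)).comp
      (fderiv ℝ (fderiv ℝ F) y)

/-- The induced connection, as a field of continuous bilinear maps. -/
def inducedField (F ζ : Rn n → Rn (n + 1)) (y : Rn n) : Rn n →L[ℝ] Rn n →L[ℝ] Rn n :=
  (ContinuousLinearMap.compL ℝ (Rn n) (Rn (n + 1)) (Rn n)
    ((ContinuousLinearMap.fst ℝ (Rn n) ℝ).comp (gaussFrame F ζ y).inverse)).comp
      (fderiv ℝ (fderiv ℝ F) y)

/-- The shape operator, as a field of continuous endomorphisms. -/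
def shapeField (F ζ : Rn n → Rn (n + 1)) (y : Rn n) : Rn n →L[ℝ] Rn n :=
  -((ContinuousLinearMap.fst ℝ (Rn n) ℝ).comp (gaussFrame F ζ y).inverse).comp (fderiv ℝ ζ y)

theorem gaussFrame_apply (F ζ : Rn n → Rn (n + 1)) (y v : Rn n) (t : ℝ) :
    gaussFrame F ζ y (v, t) = fderiv ℝ F y v + t • ζ y := by
  simp [gaussFrame]

theorem gaussFrame_isInvertible {F ζ : Rn n → Rn (n + 1)} {y : Rn n}
    (h : ∀ v (t : ℝ), fderiv ℝ F y v + t • ζ y = 0 → v = 0 ∧ t = 0) :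
    (gaussFrame F ζ y).IsInvertible := by
  have hinj : Function.Injective (gaussFrame F ζ y : (Rn n × ℝ) →ₗ[ℝ] Rn (n + 1)) := by
    rw [injective_iff_map_eq_zero]
    rintro ⟨v, t⟩ hv
    obtain ⟨h1, h2⟩ := h v t (by rw [← gaussFrame_apply]; exact hv)
    rw [h1, h2]
    rfl
  refine ⟨(LinearMap.linearEquivOfInjective _ hinj (by simp)).toContinuousLinearEquiv, ?_⟩
  ext v <;> rfl

section Field

variable {F ζ : Rn n → Rn (n + 1)} {U : Set (Rn n)} (hU : IsOpen U)
  (hF : ContDiffOn ℝ ∞ F U) (hζ : ContDiffOn ℝ ∞ ζ U)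
  (hframe : ∀ y ∈ U, ∀ v (t : ℝ), fderiv ℝ F y v + t • ζ y = 0 → v = 0 ∧ t = 0)

include hU hF hζ hframe in
theorem contDiffOn_inverse_gaussFrame :
    ContDiffOn ℝ ∞ (fun z => (gaussFrame F ζ z).inverse) U := by
  have h : ContDiffOn ℝ ∞ (gaussFrame F ζ) U := by
    rw [contDiffOn_clm_apply]
    rintro ⟨v, t⟩
    simp only [gaussFrame_apply]
    exact ((ContDiffOn.fderiv_infty hU hF).clm_apply contDiffOn_const).add
      (hζ.const_smul t)
  intro y hy
  exact ((gaussFrame_isInvertible (hframe y hy)).contDiffAt_map_inverse).comp_contDiffWithinAt y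
    (h y hy)

include hU hF hζ hframe in
theorem contDiffOn_secondFormField : ContDiffOn ℝ ∞ (secondFormField F ζ) U := by
  have h1 := contDiffOn_inverse_gaussFrame hU hF hζ hframe
  have h2 := ContDiffOn.fderiv_infty hU (ContDiffOn.fderiv_infty hU hF)
  rw [contDiffOn_clm_apply]
  intro u
  rw [contDiffOn_clm_apply]
  intro v
  exact contDiff_snd.comp_contDiffOn
    (h1.clm_apply ((h2.clm_apply contDiffOn_const).clm_apply contDiffOn_const))

include hU hF hζ hframe in
theorem contDiffOn_inducedField : ContDiffOn ℝ ∞ (inducedField F ζ) U := by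
  have h1 := contDiffOn_inverse_gaussFrame hU hF hζ hframe
  have h2 := ContDiffOn.fderiv_infty hU (ContDiffOn.fderiv_infty hU hF)
  rw [contDiffOn_clm_apply]
  intro u
  rw [contDiffOn_clm_apply]
  intro v
  exact contDiff_fst.comp_contDiffOn
    (h1.clm_apply ((h2.clm_apply contDiffOn_const).clm_apply contDiffOn_const))

include hU hF hζ hframe in
theorem contDiffOn_shapeField : ContDiffOn ℝ ∞ (shapeField F ζ) U := by
  have h1 := contDiffOn_inverse_gaussFrame hU hF hζ hframe
  rw [contDiffOn_clm_apply]
  intro v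
  exact (contDiff_fst.comp_contDiffOn
    (h1.clm_apply ((ContDiffOn.fderiv_infty hU hζ).clm_apply contDiffOn_const))).neg

include hU hF in
theorem dirDeriv_dirDeriv {y : Rn n} (hy : y ∈ U) (u v : Rn n) :
    dirDeriv (fun z => dirDeriv F z v) y u = fderiv ℝ (fderiv ℝ F) y u v :=
  fderiv_apply_const
    (ContDiffOn.differentiableAt_of_isOpen hU (ContDiffOn.fderiv_infty hU hF) hy) v u

include hU hF in
theorem secondForm_eq {y : Rn n} (hy : y ∈ U) (u v : Rn n) :
    secondForm F ζ y u v = secondFormField F ζ y u v := by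
  rw [secondForm, dirDeriv_dirDeriv hU hF hy]
  rfl

include hU hF in
theorem inducedConnection_eq {y : Rn n} (hy : y ∈ U) (u v : Rn n) :
    inducedConnection F ζ y u v = inducedField F ζ y u v := by
  rw [inducedConnection, dirDeriv_dirDeriv hU hF hy]
  rfl

/-- The mean curvature `(1/n) tr S`. -/
def meanCurvature (F ζ : Rn n → Rn (n + 1)) (y : Rn n) : ℝ :=
  (n : ℝ)⁻¹ * opTrace (shapeField F ζ y)

-- The function H is not assumed smooth, whereas the normalised trace of S is; it stands in for H
-- from here on. For n = 0 the inverse takes its default value 0, and all vectors coincide.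
theorem meanCurvature_smul {y : Rn n} {c : ℝ} (h : ∀ v, shapeOperator F ζ y v = c • v)
    (v : Rn n) : meanCurvature F ζ y • v = c • v := by
  rcases Nat.eq_zero_or_pos n with rfl | hn
  · exact Subsingleton.elim _ _
  · have e : shapeField F ζ y = c • 1 := by
      ext1 v
      exact h v
    rw [meanCurvature, e, map_smul, opTrace_one, finrank_euclideanSpace_fin, smul_eq_mul,
      mul_comm c, inv_mul_cancel_left₀ (by positivity)]

theorem meanCurvature_nonpos {y : Rn n} {c : ℝ} (h : ∀ v, shapeOperator F ζ y v = c • v)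
    (hc : c ≤ 0) : meanCurvature F ζ y ≤ 0 := by
  have e : shapeField F ζ y = c • 1 := by
    ext1 v
    exact h v
  rw [meanCurvature, e, map_smul, opTrace_one, smul_eq_mul]
  exact mul_nonpos_of_nonneg_of_nonpos (by positivity)
    (mul_nonpos_of_nonpos_of_nonneg hc (by positivity))

include hU hF hζ hframe in
theorem sphereEquations {H : Rn n → ℝ}
    (htan : ∀ y ∈ U, ∀ v, ∃ w, fderiv ℝ ζ y v = fderiv ℝ F y w)
    (hshape : ∀ y ∈ U, ∀ v, shapeOperator F ζ y v = H y • v) :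
    SphereEquations U F ζ (secondFormField F ζ) (inducedField F ζ) (meanCurvature F ζ) where
  isOpen := hU
  smooth_map := hF
  smooth_field := hζ
  smooth_form := contDiffOn_secondFormField hU hF hζ hframe
  smooth_connection := contDiffOn_inducedField hU hF hζ hframe
  smooth_curvature := contDiffOn_const.mul
    ((opTrace (V := Rn n)).contDiff.comp_contDiffOn (contDiffOn_shapeField hU hF hζ hframe))
  frame := hframe
  gauss := fun y hy u v => by
    rw [← gaussFrame_apply]
    exact ((gaussFrame_isInvertible (hframe y hy)).self_apply_inverse _).symm
  weingarten := fun y hy v => by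
    -- The shape operator sees only the tangential part of D_v ζ; equiaffinity ensures that nothing
    -- is lost.
    obtain ⟨w, hw⟩ := htan y hy v
    have h1 : shapeOperator F ζ y v = -w := by
      rw [shapeOperator, tangentPart, dirDeriv, hw,
        show fderiv ℝ F y w = gaussFrame F ζ y (w, 0) by simp [gaussFrame_apply],
        (gaussFrame_isInvertible (hframe y hy)).inverse_apply_self]
    have h2 := meanCurvature_smul (hshape y hy) v
    rw [← hshape y hy, h1] at h2
    rw [neg_smul, ← map_smul, h2, map_neg, neg_neg, hw]

end Field

/-- Trace of the identity dh(w)v = dh(v)w over v. The factor must stay: for n = 1 the function h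
need not be constant. -/
theorem sub_one_mul_fderiv_curvature {V W : Type*} [NormedAddCommGroup V] [NormedSpace ℝ V]
    [FiniteDimensional ℝ V] [NormedAddCommGroup W] [NormedSpace ℝ W]
    {U : Set V} {F ζ : V → W} {g : V → V →L[ℝ] V →L[ℝ] ℝ}
    {Γ' : V → V →L[ℝ] V →L[ℝ] V} {h : V → ℝ} (hE : SphereEquations U F ζ g Γ' h)
    {y : V} (hy : y ∈ U) (w : V) : (Module.finrank ℝ V - 1 : ℝ) * fderiv ℝ h y w = 0 := by
  have e : fderiv ℝ h y w • (1 : V →L[ℝ] V) = (fderiv ℝ h y).smulRight w := by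
    ext v
    exact hE.fderiv_curvature_smul hy w v
  have e2 := congrArg opTrace e
  rw [map_smul, opTrace_one, smul_eq_mul] at e2
  have e3 : opTrace ((fderiv ℝ h y).smulRight w) = fderiv ℝ h y w :=
    LinearMap.trace_smulRight (fderiv ℝ h y : V →ₗ[ℝ] ℝ) w
  rw [e3] at e2
  linarith

theorem curvature_eq {U : Set (Rn n)} (hU : IsOpen U) {Γ : Rn n → Rn n → Rn n → Rn n}
    {Γ₀ : Rn n → Rn n →L[ℝ] Rn n →L[ℝ] Rn n} (hΓ₀ : ContDiffOn ℝ ∞ Γ₀ U)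
    (h : ∀ y ∈ U, ∀ u v, Γ y u v = Γ₀ y u v) {y : Rn n} (hy : y ∈ U) (u v w : Rn n) :
    curvature Γ y u v w = curvEnd Γ₀ y u v w := by
  have d := ContDiffOn.differentiableAt_of_isOpen hU hΓ₀ hy
  have e : ∀ u v w, dirDeriv (fun z => Γ z v w) y u = fderiv ℝ Γ₀ y u v w := fun u v w => by
    rw [dirDeriv, fderiv_congr_of_isOpen hU (fun z hz => h z hz v w) hy, fderiv_apply_const₂ d]
  simp only [curvature, e, h y hy, curvEnd, add_apply, sub_apply, mul_apply_eq_comp]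

theorem ricci_eq {U : Set (Rn n)} (hU : IsOpen U) {Γ : Rn n → Rn n → Rn n → Rn n}
    {Γ₀ : Rn n → Rn n →L[ℝ] Rn n →L[ℝ] Rn n} (hΓ₀ : ContDiffOn ℝ ∞ Γ₀ U)
    (h : ∀ y ∈ U, ∀ u v, Γ y u v = Γ₀ y u v) {y : Rn n} (hy : y ∈ U) (v w : Rn n) :
    ricci Γ y v w = ricciForm Γ₀ y v w := by
  simp only [ricci, curvature_eq hU hΓ₀ h hy, ricciForm_apply, opTrace_eq_sum_coord, ricciOp_apply]

theorem leviCivita_eq {U : Set (Rn n)} (hU : IsOpen U) {g : Rn n → Rn n → Rn n → ℝ}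
    {G : Rn n → Rn n →L[ℝ] Rn n →L[ℝ] ℝ} (hG : ContDiffOn ℝ ∞ G U)
    (h : ∀ y ∈ U, ∀ u v, g y u v = G y u v) (hs : ∀ y ∈ U, ∀ v w, G y v w = G y w v)
    (hp : ∀ y ∈ U, ∀ v, v ≠ 0 → 0 < G y v v) {y : Rn n} (hy : y ∈ U) (u v : Rn n) :
    leviCivita g y u v = leviCivitaForm G y u v := by
  have d := ContDiffOn.differentiableAt_of_isOpen hU hG hy
  have e : ∀ u v w, dirDeriv (fun z => g z v w) y u = fderiv ℝ G y u v w := fun u v w => by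
    rw [dirDeriv, fderiv_congr_of_isOpen hU (fun z hz => h z hz v w) hy, fderiv_apply_const₂ d]
  rw [leviCivita, ← sum_coord_smul (leviCivitaForm G y u v)]
  refine Finset.sum_congr rfl fun k _ => ?_
  congr 1
  simp only [e]
  rw [← sum_inverseMetric_mul (h y hy) (hs y hy) (hp y hy)]
  refine Finset.sum_congr rfl fun l _ => ?_
  rw [leviCivitaForm_spec (hp y hy), koszul_apply]

end Coordinates

/-! ### From the structure equations to rigidity in one chart. -/

section Coordinates

variable {n : ℕ}

/-- The rigidity theorem in a coordinate domain. -/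
theorem coordinate_rigidity {F ζ : Rn n → Rn (n + 1)} {U : Set (Rn n)} (hU : IsOpen U)
    (hF : ContDiffOn ℝ ∞ F U) (hζ : ContDiffOn ℝ ∞ ζ U)
    (hframe : ∀ y ∈ U, ∀ v (t : ℝ), fderiv ℝ F y v + t • ζ y = 0 → v = 0 ∧ t = 0)
    (htan : ∀ y ∈ U, ∀ v, ∃ w, fderiv ℝ ζ y v = fderiv ℝ F y w)
    (hconv : ∀ y ∈ U, ∀ v, v ≠ 0 → 0 < secondForm F ζ y v v)
    {H : Rn n → ℝ} (hshape : ∀ y ∈ U, ∀ v, shapeOperator F ζ y v = H y • v)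
    (hH : ∀ y ∈ U, H y ≤ 0)
    (htau : ∀ y ∈ U, ∀ u v, covDerivOne (hatConnection F ζ) (czebyshevForm F ζ) y u v = 0)
    (hric : ∀ y ∈ U, ∀ v, 0 ≤ ricci (hatConnection F ζ) y v v)
    {c : ℝ} (hrho : ∀ y ∈ U, scalarCurvature (secondForm F ζ) y = c) {y : Rn n} (hy : y ∈ U) :
    (∀ u v w, curvature (hatConnection F ζ) y u v w = 0) ∧
    (∀ u v w x, covDerivThree (hatConnection F ζ) (cubicForm F ζ) y u v w x = 0) := by
  have hE := sphereEquations hU hF hζ hframe htan hshape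
  set G := secondFormField F ζ with hGdef
  set Γ' := inducedField F ζ
  set Γ := leviCivitaForm G with hΓdef
  set K : Rn n → Rn n →L[ℝ] Rn n →L[ℝ] Rn n := fun y => Γ' y - Γ y with hK
  have hg : ∀ y ∈ U, ∀ u v, secondForm F ζ y u v = G y u v := fun y hy =>
    secondForm_eq hU hF hy
  have hp : ∀ y ∈ U, ∀ v, v ≠ 0 → 0 < G y v v := fun y hy v hv => by
    rw [← hg y hy]; exact hconv y hy v hv
  have hs : ∀ y ∈ U, ∀ v w, G y v w = G y w v := fun y hy v w => (hE.symm hy v w).2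
  have hS : StatisticalField U G Γ K := statisticalField_of_codazzi hU hE.smooth_form hE.smooth_connection hs hp
    (fun y hy u v => (hE.symm hy u v).1) (fun y hy u v w => (hE.gauss_codazzi hy u v w).2)
  have hΓ : ∀ y ∈ U, ∀ u v, hatConnection F ζ y u v = Γ y u v := fun y hy =>
    leviCivita_eq hU hE.smooth_form hg hs hp hy
  have dG : ∀ y ∈ U, DifferentiableAt ℝ G y := fun y hy => hS.differentiableAt_metric hy
  have dK : ∀ y ∈ U, DifferentiableAt ℝ K y := fun y hy => hS.differentiableAt_tensor hy
  -- the cubic form and the Czebyshev form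
  have hA : ∀ y ∈ U, ∀ u v w, cubicForm F ζ y u v w = G y (K y u v) w := by
    intro y hy u v w
    rw [cubicForm, covDerivTwo, dirDeriv,
      fderiv_congr_of_isOpen hU (fun z hz => hg z hz v w) hy, fderiv_apply_const₂ (dG y hy),
      hS.metric y hy, hg y hy, hg y hy, inducedConnection_eq hU hF hy,
      inducedConnection_eq hU hF hy]
    have h1 := hS.tensor_selfAdjoint y hy u v w
    simp only [hK, sub_apply, map_sub] at h1 ⊢
    linarith
  have hτ : ∀ y ∈ U, ∀ u, czebyshevForm F ζ y u = opTrace (K y u) := fun y hy u =>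
    metricTrace_eq (hg y hy) (hs y hy) (hp y hy) (hA y hy u)
  have htr : ∀ y ∈ U, ∀ u v, opTrace (covForm Γ K y u v) = 0 := by
    intro y hy u v
    rw [← htau y hy u v, covDerivOne, dirDeriv,
      fderiv_congr_of_isOpen hU (fun z hz => hτ z hz v) hy, hτ y hy, hΓ y hy,
      covForm_eq (dK y hy), map_sub,
      opTrace_covEnd ((dK y hy).clm_apply (differentiableAt_const v))]
  -- the Gauss equation for the metric and the Codazzi equation for the cubic form
  have hcurv : ∀ y ∈ U, ∀ s a, curvEnd Γ' y s a = curvEnd Γ y s a +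
      (covForm Γ K y s a - covForm Γ K y a s) + (K y s * K y a - K y a * K y s) := by
    intro y hy s a
    have e : fderiv ℝ Γ' y = fderiv ℝ Γ y + fderiv ℝ K y := by
      rw [← fderiv_add (hS.differentiableAt_connection hy) (dK y hy)]
      congr 1
      ext1 z
      simp [hK]
    have e' : Γ' y = Γ y + K y := by simp [hK]
    simp only [curvEnd, covForm_apply, e, e', add_apply, hS.torsion_free y hy a s]
    noncomm_ring
  -- The antisymmetrised ∇̂K is g-selfadjoint, but by `hcurv` it is a combination of g-skew
  -- endomorphisms. Comparing (v, w) with (w, v) forces it to vanish.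
  have hskew : ∀ y ∈ U, ∀ s a v w, G y (covForm Γ K y s a v) w = G y (covForm Γ K y a s v) w := by
    intro y hy s a v w
    have h1 := hcurv y hy s a
    rw [show curvEnd Γ' y s a = meanCurvature F ζ y • wedgeOp (G y) s a by
      ext1 v; exact (hE.gauss_codazzi hy s a v).1] at h1
    have h2 : ∀ v w, G y ((covForm Γ K y s a - covForm Γ K y a s) v) w =
        meanCurvature F ζ y * G y (wedgeOp (G y) s a v) w - G y (curvEnd Γ y s a v) w
          - G y ((K y s * K y a - K y a * K y s) v) w := by
      intro v w
      rw [show covForm Γ K y s a - covForm Γ K y a s = meanCurvature F ζ y • wedgeOp (G y) s a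
        - curvEnd Γ y s a - (K y s * K y a - K y a * K y s) by rw [h1]; abel]
      simp only [sub_apply, smul_apply, map_sub, map_smul, smul_eq_mul]
    have h3 := h2 v w
    have h4 := h2 w v
    rw [wedgeOp_skew (hs y hy), hS.curvEnd_skew hy,
      commutator_skew (hS.tensor_selfAdjoint y hy), hs y hy v, hs y hy v, hs y hy v] at h3
    simp only [sub_apply, map_sub] at h3 h4
    linarith [hS.covForm_selfAdjoint hy s a w v, hs y hy w (covForm Γ K y s a v),
      hS.covForm_selfAdjoint hy a s w v, hs y hy w (covForm Γ K y a s v)]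
  have hcod : ∀ y ∈ U, ∀ u v, covForm Γ K y u v = covForm Γ K y v u := fun y hy u v => by
    ext1 w
    exact eq_of_forall_metric (hp y hy) (hskew y hy u v w)
  have hgauss : ∀ y ∈ U, ∀ s a, curvEnd Γ y s a =
      meanCurvature F ζ y • wedgeOp (G y) s a - (K y s * K y a - K y a * K y s) := by
    intro y hy s a
    have h1 := hcurv y hy s a
    rw [hcod y hy s a, sub_self, add_zero] at h1
    rw [eq_sub_iff_add_eq, ← h1]
    ext1 v
    exact (hE.gauss_codazzi hy s a v).1
  have hricci : ∀ y ∈ U, ∀ v w, ricci (hatConnection F ζ) y v w = ricciForm Γ y v w :=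
    fun y hy => ricci_eq hU hS.smooth_connection hΓ hy
  have main := hS.rigidity hcod hgauss htr
    (fun y hy => ContDiffOn.differentiableAt_of_isOpen hU hE.smooth_curvature hy)
    (fun y hy => sub_one_mul_fderiv_curvature hE hy)
    (fun y hy => meanCurvature_nonpos (hshape y hy) (hH y hy))
    (fun y hy v => by rw [← ricciForm_apply, ← hricci y hy]; exact hric y hy v)
    (c := c) (fun y hy => by
      rw [← hrho y hy, scalarCurvature, formTrace]
      refine (metricTrace_eq (hg y hy) (hs y hy) (hp y hy) fun v w => ?_).symm
      rw [raise_spec (hp y hy)]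
      exact hricci y hy v w) hy
  constructor
  · intro u v w
    rw [show curvature (hatConnection F ζ) y u v w = curvEnd Γ y u v w from
      curvature_eq hU hS.smooth_connection hΓ hy u v w, main.2, zero_apply]
  · intro u v w x
    -- As g is parallel, ∇̂A is ∇̂K with an index lowered.
    have h0 : G y (covForm Γ K y u v w) x = 0 := by
      rw [main.1, zero_apply, map_zero, zero_apply]
    have dKv := (dK y hy).clm_apply (differentiableAt_const v)
    rw [← h0, covDerivThree, dirDeriv,
      fderiv_congr_of_isOpen hU (fun z hz => hA z hz v w x) hy,
      hS.fderiv_pairing hy (dKv.clm_apply (differentiableAt_const w)) (differentiableAt_const x),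
      fderiv_apply_const₂ (dK y hy), covForm_apply]
    simp only [hA y hy, hΓ y hy, fderiv_fun_const, Pi.zero_apply, zero_apply, zero_add, add_apply,
      sub_apply, mul_apply_eq_comp, map_add, map_sub]
    ring

end Coordinates

/-! ### Passage to charts -/

section Charts

variable {n : ℕ} {M : Type*} [TopologicalSpace M] [ChartedSpace (Rn n) M]

theorem contDiffOn_comp_chart {f : M → Rn (n + 1)}
    (hf : ContMDiff (𝓡 n) 𝓘(ℝ, Rn (n + 1)) ∞ f) {e : OpenPartialHomeomorph M (Rn n)}
    (he : e ∈ IsManifold.maximalAtlas (𝓡 n) ∞ M) : ContDiffOn ℝ ∞ (f ∘ e.symm) e.target := by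
  rw [← contMDiffOn_iff_contDiffOn]
  exact hf.comp_contMDiffOn (contMDiffOn_symm_of_mem_maximalAtlas he)

/-- A single T, the derivative of the inverse chart, must serve every map, since the frame and
tangency conditions compare f with ξ. -/
theorem exists_fderiv_comp_chart {e : OpenPartialHomeomorph M (Rn n)}
    (he : e ∈ IsManifold.maximalAtlas (𝓡 n) ∞ M) {y : Rn n} (hy : y ∈ e.target) :
    ∃ T : Rn n →L[ℝ] TangentSpace (𝓡 n) (e.symm y), Function.Bijective T ∧
      ∀ f : M → Rn (n + 1), ContMDiff (𝓡 n) 𝓘(ℝ, Rn (n + 1)) ∞ f → ∀ v,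
        fderiv ℝ (f ∘ e.symm) y v = mfderiv (𝓡 n) 𝓘(ℝ, Rn (n + 1)) f (e.symm y) (T v) := by
  have hd : e.MDifferentiable (𝓡 n) (𝓡 n) :=
    ⟨(contMDiffOn_of_mem_maximalAtlas he).mdifferentiableOn (by simp),
      (contMDiffOn_symm_of_mem_maximalAtlas he).mdifferentiableOn (by simp)⟩
  refine ⟨mfderiv (𝓡 n) (𝓡 n) e.symm y, hd.symm.mfderiv_bijective hy, fun f hf v => ?_⟩
  rw [← mfderiv_eq_fderiv, mfderiv_comp y (hf.mdifferentiableAt (by simp))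
    (hd.mdifferentiableAt_symm hy)]
  rfl

theorem IsEquiaffineHypersurface.frame {f ξ : M → Rn (n + 1)} (h : IsEquiaffineHypersurface f ξ)
    {e : OpenPartialHomeomorph M (Rn n)} (he : e ∈ IsManifold.maximalAtlas (𝓡 n) ∞ M)
    {y : Rn n} (hy : y ∈ e.target) (v : Rn n) (t : ℝ)
    (hv : fderiv ℝ (f ∘ e.symm) y v + t • (ξ ∘ e.symm) y = 0) : v = 0 ∧ t = 0 := by
  obtain ⟨T, hT, hfd⟩ := exists_fderiv_comp_chart (n := n) he hy
  have ht : t = 0 := by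
    by_contra ht
    -- Solving F_* v + t ζ = 0 for ζ would make ζ tangent.
    refine h.transversal (e.symm y) (T (-t⁻¹ • v)) ((hfd f h.smooth_immersion _).symm.trans ?_)
    rw [map_smul, eq_neg_of_add_eq_zero_left hv, neg_smul, smul_neg, neg_neg, smul_smul,
      inv_mul_cancel₀ ht, one_smul]
    rfl
  rw [ht, zero_smul, add_zero] at hv
  refine ⟨hT.1 (h.immersion (e.symm y) ?_), ht⟩
  refine (hfd f h.smooth_immersion v).symm.trans (Eq.trans ?_ (hfd f h.smooth_immersion 0))
  rw [hv, map_zero]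

theorem IsEquiaffineHypersurface.tangential {f ξ : M → Rn (n + 1)}
    (h : IsEquiaffineHypersurface f ξ)
    {e : OpenPartialHomeomorph M (Rn n)} (he : e ∈ IsManifold.maximalAtlas (𝓡 n) ∞ M)
    {y : Rn n} (hy : y ∈ e.target) (v : Rn n) :
    ∃ w, fderiv ℝ (ξ ∘ e.symm) y v = fderiv ℝ (f ∘ e.symm) y w := by
  obtain ⟨T, hT, hfd⟩ := exists_fderiv_comp_chart (n := n) he hy
  obtain ⟨w, hw⟩ := h.equiaffine (e.symm y) (T v)
  obtain ⟨w', rfl⟩ := hT.2 w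
  exact ⟨w', by rw [hfd ξ h.smooth_field, hfd f h.smooth_immersion, hw]⟩

end Charts

end EquiaffineGeometry

end

/-! ### The theorem on the manifold. -/

theorem theorem4p19 {n : ℕ} {M : Type*} [TopologicalSpace M]
    [ChartedSpace (EquiaffineGeometry.Rn n) M] [IsManifold (𝓡 n) ∞ M]
    (f ξ : M → EquiaffineGeometry.Rn (n + 1))
    (hsphere : EquiaffineGeometry.IsHyperbolicSphere f ξ ∨
      EquiaffineGeometry.IsParabolicSphere f ξ)
    -- the Czebyshev form is parallel for the Levi-Civita connection
    (htau : EquiaffineGeometry.InCharts f ξ fun F ζ y => ∀ u v,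
      EquiaffineGeometry.covDerivOne (EquiaffineGeometry.hatConnection F ζ)
        (EquiaffineGeometry.czebyshevForm F ζ) y u v = 0)
    -- the Ricci tensor of the metric is positive semidefinite
    (hric : EquiaffineGeometry.InCharts f ξ fun F ζ y => ∀ v,
      0 ≤ EquiaffineGeometry.ricci (EquiaffineGeometry.hatConnection F ζ) y v v)
    -- the scalar curvature of the metric is constant
    (hrho : ∃ c : ℝ, EquiaffineGeometry.InCharts f ξ fun F ζ y =>
      EquiaffineGeometry.scalarCurvature (EquiaffineGeometry.secondForm F ζ) y = c) :
    -- the metric is flat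
    (EquiaffineGeometry.InCharts f ξ fun F ζ y => ∀ u v w,
      EquiaffineGeometry.curvature (EquiaffineGeometry.hatConnection F ζ) y u v w = 0) ∧
    -- the cubic form is parallel for the Levi-Civita connection
    (EquiaffineGeometry.InCharts f ξ fun F ζ y => ∀ u v w x,
      EquiaffineGeometry.covDerivThree (EquiaffineGeometry.hatConnection F ζ)
        (EquiaffineGeometry.cubicForm F ζ) y u v w x = 0) := by

  -- The hyperbolic and parabolic cases enter only through H ≤ 0, the sign needed for -2Hρ̂ ≥ 0.
  obtain ⟨H, hH, hneg⟩ : ∃ H : M → ℝ, EquiaffineGeometry.IsEquiaffineSphere f ξ H ∧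
      ∀ x, H x ≤ 0 := by
    rcases hsphere with ⟨H, h, h'⟩ | ⟨H, h, h'⟩
    · exact ⟨H, h, fun x => (h' x).le⟩
    · exact ⟨H, h, fun x => (h' x).le⟩
  obtain ⟨c, hc⟩ := hrho
  have hf := hH.hypersurface
  have main := fun (e : OpenPartialHomeomorph M (EquiaffineGeometry.Rn n))
      (he : e ∈ IsManifold.maximalAtlas (𝓡 n) ∞ M) y (hy : y ∈ e.target) =>
    EquiaffineGeometry.coordinate_rigidity e.open_target
      (EquiaffineGeometry.contDiffOn_comp_chart hf.smooth_immersion he)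
      (EquiaffineGeometry.contDiffOn_comp_chart hf.smooth_field he)
      (fun y hy => hf.frame he hy) (fun y hy => hf.tangential he hy)
      (fun y hy => hf.convex e he y hy) (H := fun y => H (e.symm y)) (hH.shape e he)
      (fun y _ => hneg _) (htau e he) (hric e he) (hc e he) hy
  exact ⟨fun e he y hy => (main e he y hy).1, fun e he y hy => (main e he y hy).2⟩
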